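/- Let $k$ be an algebraically closed field of characteristic $p\ge 0$, let $V$ be a $k$-vector space of dimension $2l\ge 8$ with a non-degenerate quadratic form, and let $\mathrm{SO}(V)$ be the corresponding special orthogonal group (the identity component of the full orthogonal group; for $p=2$, the isometries of trivial Dickson invariant). Let $T\ne 1$ be a torus and let $u$ be a regular unipotent element of $\mathrm{SO}(V)$ (a unipotent element whose $\mathrm{SO}(V)$-class is dense in the variety of unipotent elements of $\mathrm{SO}(V)$), such that $u$ normalises $T$ and $X=T\langle u\rangle\le\mathrm{SO}(V)$. Then $p=2$. Moreover, $V$ is the direct sum $V=V_1\oplus\cdots\oplus V_r$ of the (non-zero, pairwise distinct) weight spaces of $T$ on $V$, and, up to renumbering the $V_i$, one of the following holds: 1. $r=2$, $l$ is even, $u$ interchanges $V_1$ and $V_2$, and $u^2$ acts with Jordan blocks of sizes $l-1,1$ on both $V_1$ and $V_2$; 2. $r=2^s+1$ for some $s\ge 1$, $\langle u\rangle$ permutes $V_1,\ldots,V_{r-1}$ transitively, and $V_r$ is the weight space of the zero weight, with $\dim V_r=2$; or 3. $r=2^s+2$ for some $s\ge 0$, $\langle u\rangle$ acts transitively on $\{V_1,\ldots,V_{r-2}\}$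 and on $\{V_{r-1},V_r\}$, and $V_{r-1}$ and $V_r$ are $1$-dimensional weight spaces for opposed weights. -/

import Mathlib

namespace TorusOrth

/-- The coordinate ring of the affine algebraic group `Aˣ`, for a finite-dimensional algebra `A`
over an algebraically closed field `k`, as an algebra of functions on `Aˣ`: it is generated by the
linear functionals of `g` and of `g⁻¹`.  For `A = Module.End k V` this is `k[GL(V)]` (generated by
the matrix entries and the inverse of the determinant); for `A = Fin n → k` the group `Aˣ` is
`𝔾ₘⁿ` and this is the ring of Laurent polynomials in `n` variables. -/
def regularFunctions (k A : Type*) [Field k] [Ring A] [Algebra k A] : Subalgebra k (Aˣ → k) :=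
  Algebra.adjoin k
    ({f | ∃ ℓ : Module.Dual k A, f = fun g : Aˣ => ℓ (g : A)} ∪
      {f | ∃ ℓ : Module.Dual k A, f = fun g : Aˣ => ℓ ((g⁻¹ : Aˣ) : A)})

/-- The Zariski closure of a subset of the algebraic group `Aˣ`. -/
def zariskiClosure (k : Type*) {A : Type*} [Field k] [Ring A] [Algebra k A] (S : Set Aˣ) :
    Set Aˣ :=
  {g | ∀ f ∈ regularFunctions k A, (∀ s ∈ S, f s = 0) → f g = 0}

section

variable {k V : Type*} [Field k] [AddCommGroup V] [Module k V]

/-- `T ≤ GL(V)` is a torus: a Zariski closed subgroup that is isomorphic, as an algebraic group, to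
`𝔾ₘⁿ` for some `n`.  The isomorphism `φ` and its inverse are morphisms of varieties: regular
functions pull back to regular functions (those on the closed set `T` are the restrictions of
regular functions on `GL(V)`). -/
def IsTorus (T : Subgroup (Module.End k V)ˣ) : Prop :=
  zariskiClosure k (T : Set (Module.End k V)ˣ) ⊆ (T : Set (Module.End k V)ˣ) ∧
  ∃ (n : ℕ) (φ : (Fin n → k)ˣ ≃* T),
    (∀ f ∈ regularFunctions k (Module.End k V),
      (fun t : (Fin n → k)ˣ => f (φ t : (Module.End k V)ˣ)) ∈ regularFunctions k (Fin n → k)) ∧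
    (∀ f ∈ regularFunctions k (Fin n → k), ∃ F ∈ regularFunctions k (Module.End k V),
      ∀ t : T, F (t : (Module.End k V)ˣ) = f (φ.symm t))

/-- The special orthogonal group `SO(V)` of a non-degenerate quadratic form `Q` on a space of even
dimension: the isometries of `Q` of trivial Dickson invariant, i.e. the isometries `g` for which
`g - 1` has even rank.  In characteristic different from `2` these are the isometries of
determinant `1`; in every characteristic they form the identity component of the full orthogonal
group. -/
def specialOrthogonal (Q : QuadraticForm k V) : Set (Module.End k V)ˣ :=
  {g | (∀ v, Q ((g : Module.End k V) v) = Q v) ∧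
    Even (Module.finrank k (LinearMap.range ((g : Module.End k V) - 1)))}

/-- `g ∈ GL(V)` is unipotent. -/
def IsUnipotent (g : (Module.End k V)ˣ) : Prop :=
  IsNilpotent ((g : Module.End k V) - 1)

/-- `u` is a regular unipotent element of `SO(V)`: it is a unipotent element whose
`SO(V)`-conjugacy class is Zariski dense in the variety of unipotent elements of `SO(V)`. -/
def IsRegularUnipotent (Q : QuadraticForm k V) (u : (Module.End k V)ˣ) : Prop :=
  u ∈ specialOrthogonal Q ∧ IsUnipotent u ∧
    {v | v ∈ specialOrthogonal Q ∧ IsUnipotent v} ⊆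
      zariskiClosure k {x | ∃ h ∈ specialOrthogonal Q, x = h * u * h⁻¹}

/-- The weight space `V_χ = {v | t v = χ(t) v for all t ∈ T}`. -/
def weightSpace (T : Subgroup (Module.End k V)ˣ) (χ : T →* kˣ) : Submodule k V :=
  ⨅ t : T, Module.End.eigenspace ((t : (Module.End k V)ˣ) : Module.End k V) ((χ t : kˣ) : k)

/-- `χ 0, …, χ (r - 1)` is a numbering, without repetition, of all the weights of `T` on `V`, and
`V` is the direct sum of the corresponding (non-zero) weight spaces. -/
def IsWeightDecomposition (T : Subgroup (Module.End k V)ˣ) {r : ℕ} (χ : Fin r → (T →* kˣ)) :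
    Prop :=
  Function.Injective χ ∧
  (∀ ψ : T →* kˣ, weightSpace T ψ ≠ ⊥ ↔ ψ ∈ Set.range χ) ∧
  DirectSum.IsInternal (fun i => weightSpace T (χ i))

/-- The group generated by `u` permutes the subspaces `W i`, `i ∈ S`, and does so transitively. -/
def PermutesTransitively (u : (Module.End k V)ˣ) {ι : Type*} (W : ι → Submodule k V)
    (S : Set ι) : Prop :=
  (∀ i ∈ S, ∃ j ∈ S, (W i).map (u : Module.End k V) = W j) ∧
  (∀ i ∈ S, ∀ j ∈ S, ∃ m : ℤ, (W i).map ((u ^ m : (Module.End k V)ˣ) : Module.End k V) = W j)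

/-- The subspace `W` is invariant under `g`, and `g` acts on `W` as a unipotent map whose Jordan
blocks have the sizes `n i`, `i ∈ ι`: there is a basis of `W` in which `g` is the direct sum of
Jordan blocks with eigenvalue `1` of these sizes. -/
def HasUnipotentJordanBlocksOn (g : (Module.End k V)ˣ) (W : Submodule k V) {ι : Type*}
    (n : ι → ℕ) : Prop :=
  ∃ b : Module.Basis (Σ i, Fin (n i)) k W, ∀ (i : ι) (j : Fin (n i)),
    (g : Module.End k V) (b ⟨i, j⟩ : V) =
      (b ⟨i, j⟩ : V) + if h : (j : ℕ) + 1 < n i then (b ⟨i, ⟨(j : ℕ) + 1, h⟩⟩ : V) else 0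

end

end TorusOrth

/-!
Regularity of `u` enters only through one consequence: `(u - 1) ^ (2 * l - 3) ≠ 0`, that is, `u`
has a Jordan block of size at least `2 * l - 2`. The vanishing of a power of `g - 1` is a Zariski
closed condition invariant under conjugation, so it is enough to exhibit one unipotent element of
`SO(V)` with such a block (`IsRegularUnipotent.sub_one_pow_ne_zero`). That element is a product of
Siegel transformations along a chain of hyperbolic pairs, each of which raises the nilpotency
index by two (`HasUnipotentOrthogonalTo.step`); in characteristic two the chain starts with a
product of two reflections. Membership in `SO(V)` adds that the kernel of `u - 1` has even
dimension.

The torus is diagonalizable because its matrix coefficients are combinations of characters, and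
these are linearly independent (`IsTorus.iSup_weightSpace`). The element `u` permutes the weight
spaces, and the polar form pairs the weight space of `χ` with that of `χ⁻¹`, so inversion is a
duality on the weights that commutes with `u`. It fixes only the trivial weight, since `T` is a
divisible group.

The large Jordan block lives on one `u`-orbit of weights. As `4 ≤ l`, there is no room for a
second such orbit, so this one is closed under inversion, and at most two dimensions are left for
the other weights (`orbit_classification`). Two weights outside the large orbit are interchanged
by `u`, for otherwise the kernel of `u - 1` would have dimension three, which is odd.

If `2 ≠ 0` in `k`, every orbit has odd size, since an orbit of even size would give `u` the
eigenvalue `-1`; this excludes two weights outside the large orbit. Inversion fixes a weight in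
the large orbit, so the trivial weight lies there. It is then the only weight of that orbit,
contrary to `T ≠ 1` when there is no other weight; and a single other weight would be trivial as
well. If `2 = 0` in `k`, orbit sizes are powers of two, and what remains are the three cases of
the theorem. In the case of a single orbit of size `n`, the identity `(u - 1) ^ n = u ^ n - 1` and
the two-dimensional kernel of `u - 1` force `n = 2`. Then `l` is even because the alternating form
`B(v, u w) - B(w, u v)` on the first weight space has a two-dimensional radical
(`even_finrank_of_interchange`), and the Jordan blocks of `u ^ 2` are read off from its nilpotency
index and kernel.
-/


namespace TorusOrth

/-! ### Nilpotent maps and alternating forms -/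

section LinearAlgebra

variable {k V : Type*} [Field k] [AddCommGroup V] [Module k V]

lemma linearIndependent_pow_apply (Y : Module.End k V) {m : ℕ} {w : V} (h : (Y ^ m) w ≠ 0)
    (h' : (Y ^ (m + 1)) w = 0) : LinearIndependent k (fun j : Fin (m + 1) => (Y ^ (j : ℕ)) w) := by
  induction m generalizing w with
  | zero => simpa using h
  | succ m ih =>
    rw [linearIndependent_finSucc]
    have e : ∀ j, (Y ^ (j + 1)) w = (Y ^ j) (Y w) := fun j => by rw [pow_succ]; rfl
    constructor
    · have := ih (w := Y w) (by rwa [← e]) (by rwa [← e])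
      convert this using 2 with j
      simp [Fin.tail, e]
    · intro hmem
      have hle : Submodule.span k (Set.range (Fin.tail fun j : Fin (m + 1 + 1) => (Y ^ (j : ℕ)) w))
          ≤ LinearMap.ker (Y ^ (m + 1)) := by
        rw [Submodule.span_le]
        rintro _ ⟨j, rfl⟩
        have h3 : (Y ^ (m + 1)) ((Y ^ ((j : ℕ) + 1)) w) = (Y ^ (j : ℕ)) ((Y ^ (m + 1 + 1)) w) := by
          simp only [← Module.End.mul_apply, ← pow_add]; congr 2; omega
        simp [Fin.tail, h3, h']
      exact h (by simpa using hle hmem)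

variable [FiniteDimensional k V]

lemma finrank_inf_ker_add_one (S : Submodule k V) (f : V →ₗ[k] k) {x : V} (hx : x ∈ S)
    (hfx : f x ≠ 0) : Module.finrank k ↥(S ⊓ LinearMap.ker f) + 1 = Module.finrank k S := by
  have h0 : f.domRestrict S ≠ 0 := fun h => hfx (by simpa using LinearMap.congr_fun h ⟨x, hx⟩)
  have := Module.Dual.finrank_ker_add_one_of_ne_zero (f := f.domRestrict S) h0
  have e : S ⊓ LinearMap.ker f = (LinearMap.ker (f.domRestrict S)).map S.subtype := by
    ext y
    simp [LinearMap.mem_ker, and_comm]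
  rw [← this, e,
    ← LinearEquiv.finrank_eq (Submodule.equivSubtypeMap S (LinearMap.ker (f.domRestrict S)))]

/-- If `Y ^ m w ≠ 0`, the independent vectors `Y w, …, Y ^ m w` bound the rank of `Y` from below. -/
lemma finrank_ker_add_le_of_pow_ne_zero {Y : Module.End k V} (hY : IsNilpotent Y) {m : ℕ}
    (hm : Y ^ m ≠ 0) : Module.finrank k (LinearMap.ker Y) + m ≤ Module.finrank k V := by
  obtain ⟨w, hw⟩ : ∃ w, (Y ^ m) w ≠ 0 := by
    by_contra! h; exact hm (LinearMap.ext h)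
  classical
  obtain ⟨N, hN⟩ := hY
  have hex : ∃ n, (Y ^ n) w = 0 := ⟨N, by simp [hN]⟩
  -- `q` is the last exponent with `Y ^ q w ≠ 0`
  obtain ⟨q, hq⟩ : ∃ q, Nat.find hex = q + 1 :=
    Nat.exists_eq_succ_of_ne_zero fun h => hw (by
      have h1 := Nat.find_spec hex
      rw [h] at h1
      simp only [pow_zero, Module.End.one_apply] at h1
      simp [h1])
  have hq0 : (Y ^ (q + 1)) w = 0 := hq ▸ Nat.find_spec hex
  have hq1 : (Y ^ q) w ≠ 0 := Nat.find_min hex (by omega)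
  have hmq : m ≤ q := by
    by_contra! hlt
    obtain ⟨d, rfl⟩ := Nat.exists_eq_add_of_le (Nat.succ_le_of_lt hlt)
    apply hw
    rw [add_comm, pow_add, Module.End.mul_apply, hq0, map_zero]
  have hli := (linearIndependent_pow_apply Y hq1 hq0).comp Fin.succ (Fin.succ_injective q)
  have hsub : Submodule.span k (Set.range ((fun j : Fin (q + 1) => (Y ^ (j : ℕ)) w) ∘ Fin.succ))
      ≤ LinearMap.range Y := by
    rw [Submodule.span_le]
    rintro _ ⟨j, rfl⟩
    exact ⟨(Y ^ (j : ℕ)) w, by simp [pow_succ', Module.End.mul_apply]⟩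
  have h1 := Submodule.finrank_mono hsub
  rw [finrank_span_eq_card hli, Fintype.card_fin] at h1
  have := LinearMap.finrank_range_add_finrank_ker Y
  omega

/-- The rank of an alternating form is even: a hyperbolic pair splits off without changing the
radical. The induction is on the dimension `n`. -/
lemma even_finrank_range_of_isAlt {k : Type*} [Field k] (n : ℕ) :
    ∀ {V : Type*} [AddCommGroup V] [Module k V] [FiniteDimensional k V]
      (β : V →ₗ[k] V →ₗ[k] k), β.IsAlt → Module.finrank k V = n →
      Even (Module.finrank k (LinearMap.range β)) := by
  induction n using Nat.strong_induction_on with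
  | _ n ih =>
  intro V _ _ _ β hβ hn
  by_cases h0 : β = 0
  · rw [h0, LinearMap.range_zero, finrank_bot]
    exact Even.zero
  obtain ⟨x, y, hxy⟩ : ∃ x y, β x y ≠ 0 := by
    by_contra! h; exact h0 (LinearMap.ext₂ h)
  have hyx : β y x ≠ 0 := by rw [← hβ.neg]; simpa using hxy
  have h1 := finrank_inf_ker_add_one ⊤ (β x) (x := y) trivial hxy
  have h2 := finrank_inf_ker_add_one (⊤ ⊓ LinearMap.ker (β x)) (β y) (x := x)
    (by simpa using hβ x) hyx
  rw [finrank_top] at h1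
  set W : Submodule k V := ⊤ ⊓ LinearMap.ker (β x) ⊓ LinearMap.ker (β y) with hW
  have hWm : ∀ z, z ∈ W ↔ β x z = 0 ∧ β y z = 0 := fun z => by simp [hW, LinearMap.mem_ker]
  have key := ih (Module.finrank k W) (by omega) (β.domRestrict₁₂ W W) (fun z => hβ z) rfl
  have hker : LinearMap.ker β = (LinearMap.ker (β.domRestrict₁₂ W W)).map W.subtype := by
    ext z
    rw [LinearMap.mem_ker, Submodule.mem_map]
    constructor
    · intro hz
      have hz' : ∀ v, β v z = 0 := fun v => by rw [← hβ.neg, hz]; simp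
      refine ⟨⟨z, (hWm z).2 ⟨hz' x, hz' y⟩⟩, LinearMap.ext fun w => ?_, rfl⟩
      rw [LinearMap.domRestrict₁₂_apply]
      simp [hz]
    · rintro ⟨⟨z, hzW⟩, hz, rfl⟩
      rw [LinearMap.mem_ker] at hz
      obtain ⟨hxz, hyz⟩ := (hWm z).1 hzW
      have hzx : β z x = 0 := by rw [← hβ.neg, hxz, neg_zero]
      have hzy : β z y = 0 := by rw [← hβ.neg, hyz, neg_zero]
      ext v
      -- `v` minus its hyperbolic component lies in `W`
      have hv : v - (β x v / β x y) • y - (β y v / β y x) • x ∈ W := by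
        rw [hWm]; constructor <;> simp [hβ x, hβ y] <;> field_simp <;> ring
      have := LinearMap.congr_fun hz ⟨_, hv⟩
      rw [LinearMap.domRestrict₁₂_apply] at this
      simpa [hzx, hzy] using this
  have e1 := LinearMap.finrank_range_add_finrank_ker β
  have e2 := LinearMap.finrank_range_add_finrank_ker (β.domRestrict₁₂ W W)
  have e3 := LinearEquiv.finrank_eq
    (Submodule.equivSubtypeMap W (LinearMap.ker (β.domRestrict₁₂ W W)))
  rw [hker, ← e3] at e1
  have : Module.finrank k (LinearMap.range β) =
    Module.finrank k (LinearMap.range (β.domRestrict₁₂ W W)) + 2 := by omega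
  rw [this]
  exact key.add even_two

end LinearAlgebra

/-! ### Siegel transformations and large unipotent blocks -/

section RegularUnipotent

variable {k V : Type*} [Field k] [AddCommGroup V] [Module k V] {Q : QuadraticForm k V}

lemma map_add_polarBilin (Q : QuadraticForm k V) (x y : V) :
    Q (x + y) = Q x + Q y + Q.polarBilin x y := by
  simp [QuadraticMap.polar]

lemma polarBilin_swap (Q : QuadraticForm k V) (x y : V) : Q.polarBilin x y = Q.polarBilin y x := by
  simp [QuadraticMap.polar_comm Q x y]

lemma polarBilin_self (Q : QuadraticForm k V) (x : V) : Q.polarBilin x x = 2 * Q x := by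
  simp [QuadraticMap.polar_self]

lemma polarBilin_apply_apply {g : Module.End k V} (hg : ∀ v, Q (g v) = Q v) (x y : V) :
    Q.polarBilin (g x) (g y) = Q.polarBilin x y := by
  simp [QuadraticMap.polar, ← map_add, hg]

/-- The restriction to `U` of the polar form of `Q` is non-degenerate. -/
def NondegenerateOn (Q : QuadraticForm k V) (U : Submodule k V) : Prop :=
  ∀ x ∈ U, x ≠ 0 → ∃ y ∈ U, Q.polarBilin x y ≠ 0

/-- Over an algebraically closed field a plane contains a singular vector, which non-degeneracy
completes to a hyperbolic pair. -/
lemma exists_hyperbolic_pair [IsAlgClosed k] [FiniteDimensional k V] {U : Submodule k V}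
    (hU : NondegenerateOn Q U) (h2 : 2 ≤ Module.finrank k U) :
    ∃ e ∈ U, ∃ f ∈ U, Q e = 0 ∧ Q f = 0 ∧ Q.polarBilin e f = 1 := by
  obtain ⟨e, heU, he0, hQe⟩ : ∃ e ∈ U, e ≠ 0 ∧ Q e = 0 := by
    have : Nontrivial U := Module.nontrivial_of_finrank_pos (R := k) (by omega)
    obtain ⟨x, hx⟩ := exists_ne (0 : U)
    obtain ⟨y, hxy⟩ := exists_linearIndependent_pair_of_one_lt_finrank
      (by omega : 1 < Module.finrank k U) hx
    rw [LinearIndependent.pair_iff] at hxy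
    by_cases hy : Q (y : V) = 0
    · refine ⟨y, y.2, fun h => ?_, hy⟩
      simpa using hxy 0 1 (by simpa using h)
    · obtain ⟨t, ht⟩ := IsAlgClosed.exists_root
        (Polynomial.C (Q (y : V)) * Polynomial.X ^ 2 +
          Polynomial.C (Q.polarBilin (x : V) y) * Polynomial.X + Polynomial.C (Q (x : V)))
        (by rw [Polynomial.degree_quadratic hy]; decide)
      refine ⟨x + t • y, U.add_mem x.2 (U.smul_mem t y.2), fun h => ?_, ?_⟩
      · have h1 : (1 : k) • x + t • y = 0 := Subtype.ext (by simpa using h)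
        simpa using (hxy 1 t h1).1
      · rw [map_add_polarBilin, QuadraticMap.map_smul, map_smul]
        simp only [Polynomial.IsRoot.def, Polynomial.eval_add, Polynomial.eval_mul,
          Polynomial.eval_C, Polynomial.eval_pow, Polynomial.eval_X] at ht
        rw [← ht, smul_eq_mul, smul_eq_mul]
        ring
  obtain ⟨y, hyU, hy⟩ := hU e heU he0
  obtain ⟨f₀, hf₀U, h1⟩ : ∃ f₀ ∈ U, Q.polarBilin e f₀ = 1 :=
    ⟨(Q.polarBilin e y)⁻¹ • y, U.smul_mem _ hyU, by
      rw [map_smul, smul_eq_mul, inv_mul_cancel₀ hy]⟩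
  refine ⟨e, heU, f₀ - Q f₀ • e, U.sub_mem hf₀U (U.smul_mem _ heU), hQe, ?_, ?_⟩
  · rw [sub_eq_add_neg, ← neg_smul, map_add_polarBilin, QuadraticMap.map_smul, map_smul,
      polarBilin_swap, h1, hQe]
    simp
  · rw [map_sub, map_smul, h1, polarBilin_self, hQe]
    simp

lemma finrank_orthogonal_hyperbolic_pair [FiniteDimensional k V] {U : Submodule k V}
    {e f : V} (he : e ∈ U) (hf : f ∈ U) (hQe : Q e = 0)
    (hef : Q.polarBilin e f = 1) :
    Module.finrank k ↥(U ⊓ LinearMap.ker (Q.polarBilin e) ⊓ LinearMap.ker (Q.polarBilin f)) + 2 =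
      Module.finrank k U := by
  have h1 := finrank_inf_ker_add_one U (Q.polarBilin e) hf (by rw [hef]; exact one_ne_zero)
  have h2 := finrank_inf_ker_add_one (U ⊓ LinearMap.ker (Q.polarBilin e)) (Q.polarBilin f) (x := e)
    ⟨he, by rw [SetLike.mem_coe, LinearMap.mem_ker, polarBilin_self, hQe, mul_zero]⟩
    (by rw [polarBilin_swap, hef]; exact one_ne_zero)
  omega

lemma NondegenerateOn.orthogonal {U : Submodule k V} (hU : NondegenerateOn Q U) {e f : V}
    (he : e ∈ U) (hf : f ∈ U) (hQe : Q e = 0) (hQf : Q f = 0)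
    (hef : Q.polarBilin e f = 1) :
    NondegenerateOn Q
      (U ⊓ LinearMap.ker (Q.polarBilin e) ⊓ LinearMap.ker (Q.polarBilin f)) := by
  rintro x ⟨⟨hxU, hxe⟩, hxf⟩ hx0
  rw [SetLike.mem_coe, LinearMap.mem_ker, polarBilin_swap] at hxe hxf
  obtain ⟨y, hyU, hy⟩ := hU x hxU hx0
  refine ⟨y - Q.polarBilin f y • e - Q.polarBilin e y • f, ⟨⟨?_, ?_⟩, ?_⟩, ?_⟩
  · exact U.sub_mem (U.sub_mem hyU (U.smul_mem _ he)) (U.smul_mem _ hf)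
  · rw [SetLike.mem_coe, LinearMap.mem_ker, map_sub, map_sub, map_smul, map_smul,
      polarBilin_self, hQe, hef]
    simp
  · rw [SetLike.mem_coe, LinearMap.mem_ker, map_sub, map_sub, map_smul, map_smul,
      polarBilin_self, hQf, polarBilin_swap Q f e, hef]
    simp
  · rw [map_sub, map_sub, map_smul, map_smul, hxe, hxf]
    simpa using hy

/-- There is an isometry `g` with `(g - 1) ^ (m + 1) = 0` and `g - 1` of even rank that is the
identity on `U`, and a vector `w` orthogonal to `U` that witnesses `(g - 1) ^ m ≠ 0`, in the sense
that `(g - 1) ^ m (g w)` is not orthogonal to `w`. -/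
def HasUnipotentOrthogonalTo (Q : QuadraticForm k V) (U : Submodule k V) (m : ℕ) : Prop :=
  ∃ (g : Module.End k V) (w : V), (∀ v, Q (g v) = Q v) ∧
    Even (Module.finrank k (LinearMap.range (g - 1))) ∧ (g - 1) ^ (m + 1) = 0 ∧
    (∀ x ∈ U, g x = x) ∧ (∀ x ∈ U, Q.polarBilin w x = 0) ∧
    Q.polarBilin w (((g - 1) ^ m : Module.End k V) (g w)) ≠ 0

/-- Composing `g` with the Siegel transformation attached to a singular vector `e` and to the
witness `w` raises the nilpotency index of `g - 1` by two; the partner `f` of `e` in a hyperbolic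
pair is the new witness. -/
lemma HasUnipotentOrthogonalTo.step [FiniteDimensional k V] {U : Submodule k V} {m : ℕ}
    (h : HasUnipotentOrthogonalTo Q U m) {e f : V} (he : e ∈ U) (hf : f ∈ U) (hQe : Q e = 0)
    (hef : Q.polarBilin e f = 1) :
    HasUnipotentOrthogonalTo Q
      (U ⊓ LinearMap.ker (Q.polarBilin e) ⊓ LinearMap.ker (Q.polarBilin f)) (m + 2) := by
  obtain ⟨g, w, hg, heven, hnil, hgU, hwU, hc⟩ := h
  set B := Q.polarBilin with hB
  have hBg : ∀ x y, B (g x) (g y) = B x y := polarBilin_apply_apply hg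
  have hge := hgU e he
  have hgf := hgU f hf
  have hee : B e e = 0 := by rw [hB, polarBilin_self, hQe, mul_zero]
  have hwe := hwU e he
  have hwf := hwU f hf
  have hew : B e w = 0 := by rw [hB, polarBilin_swap]; exact hwe
  have hfe : B f e = 1 := by rw [hB, polarBilin_swap]; exact hef
  have hegx : ∀ x, B e (g x) = B e x := fun x => by rw [← hBg e x, hge]
  have hfgx : ∀ x, B f (g x) = B f x := fun x => by rw [← hBg f x, hgf]
  -- `v` is `g` composed with `x ↦ x + B(e, x) • (w - Q(w) • e) - B(w, x) • e`
  obtain ⟨v, hv⟩ : ∃ v : Module.End k V,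
      ∀ x, v x = g x + B e x • (g w - Q w • e) - B w x • e :=
    ⟨g + (B e).smulRight (g w - Q w • e) - (B w).smulRight e, fun x => by simp⟩
  have hve : v e = e := by simp [hv, hge, hee, hwe]
  have hvf : v f = f + (g w - Q w • e) := by simp [hv, hgf, hef, hwf]
  -- `g` and `v` preserve the hyperplane orthogonal to `e`, where their powers are compared
  have horth : ∀ x, B e x = 0 → ∀ n, B e (((g - 1) ^ n : Module.End k V) x) = 0 := by
    intro x hx n
    induction n with
    | zero => simpa using hx
    | succ n ih =>
      rw [pow_succ', Module.End.mul_apply, LinearMap.sub_apply, map_sub, hegx,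
        Module.End.one_apply, sub_self]
  have hpow : ∀ x, B e x = 0 → ∀ n,
      ((v - 1) ^ (n + 1)) x =
        ((g - 1) ^ (n + 1)) x - B w (((g - 1) ^ n : Module.End k V) x) • e := by
    intro x hx n
    have h1 : ∀ y, B e y = 0 → (v - 1) y = (g - 1) y - B w y • e := fun y hy => by
      simp only [LinearMap.sub_apply, hv, hy, zero_smul, add_zero, Module.End.one_apply]; abel
    induction n with
    | zero => simpa using h1 x hx
    | succ n ih =>
      rw [pow_succ', Module.End.mul_apply, ih, map_sub, map_smul, h1 _ (horth x hx _),
        pow_succ' (g - 1) (n + 1), Module.End.mul_apply]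
      simp [hve]
  set c := B w (((g - 1) ^ m : Module.End k V) (g w)) with hcdef
  have hegw : B e (g w - Q w • e) = 0 := by simp [hegx, hew, hee]
  have hm1 : ∀ x, ((g - 1) ^ (m + 1)) x = 0 := fun x => by simp [hnil]
  -- the image of `(v - 1) ^ (m + 2)` is the line through `e`
  have hm2 : ∀ x, ((v - 1) ^ (m + 2)) x = -(B e x * c) • e := by
    intro x
    have hx' : B e (x - B e x • f) = 0 := by simp [hef]
    have h1 : ((v - 1) ^ (m + 2)) (x - B e x • f) = 0 := by
      rw [hpow _ hx' (m + 1), hm1, pow_succ', Module.End.mul_apply, hm1]; simp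
    have h2 : ((v - 1) ^ (m + 2)) f = -c • e := by
      have hge' : ((g - 1) ^ m) e = 0 ∨ B w (((g - 1) ^ m : Module.End k V) e) = 0 := by
        rcases m with _ | m
        · right; simpa using hwe
        · left; rw [pow_succ, Module.End.mul_apply]; simp [hge]
      have hge'' : B w (((g - 1) ^ m : Module.End k V) e) = 0 := by
        rcases hge' with h | h
        · rw [h, map_zero]
        · exact h
      have hvf' : (v - 1) f = g w - Q w • e := by simp [hvf]
      rw [show m + 2 = m + 1 + 1 from rfl, pow_succ (v - 1) (m + 1), Module.End.mul_apply, hvf',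
        hpow _ hegw, hm1, map_sub, map_sub, map_smul, map_smul, hge'']
      simp [hcdef]
    have h3 : x = (x - B e x • f) + B e x • f := by abel
    rw [h3, map_add, h1, map_smul, h2, ← h3, smul_smul]
    simp
  refine ⟨v, f, ?_, ?_, ?_, ?_, ?_, ?_⟩
  · intro x
    have hvx : v x = g (x + (B e x • w + -(B e x * Q w + B w x) • e)) := by
      simp only [hv, map_add, map_smul, hge]; module
    rw [hvx, hg, map_add_polarBilin, map_add_polarBilin, ← hB, QuadraticMap.map_smul,
      QuadraticMap.map_smul, hQe]
    simp only [map_add, map_smul, smul_eq_mul, LinearMap.smul_apply, hwe,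
      hB ▸ polarBilin_swap Q x w, hB ▸ polarBilin_swap Q x e]
    ring
  · -- the kernel of `v - 1` has codimension two in the kernel of `g - 1`
    have hker : LinearMap.ker (v - 1) =
        LinearMap.ker (g - 1) ⊓ LinearMap.ker (B e) ⊓ LinearMap.ker (B w) := by
      ext x
      simp only [Submodule.mem_inf, LinearMap.mem_ker]
      constructor
      · intro hx
        have hex : B e x = 0 := by
          have := hm2 x
          rw [show m + 2 = (m + 1) + 1 from rfl, pow_succ, Module.End.mul_apply, hx,
            map_zero] at this
          have h1 := congrArg (B f) this
          simp only [map_zero, map_smul, hfe, smul_eq_mul, mul_one, zero_eq_neg, mul_eq_zero] at h1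
          exact h1.resolve_right hc
        have h1 := hpow x hex 0
        simp only [zero_add, pow_one, hx, pow_zero, Module.End.one_apply] at h1
        have h2 : B w x = 0 := by
          have h3 := congrArg (B f) h1
          simpa [hfe, hfgx] using h3
        refine ⟨⟨?_, hex⟩, h2⟩
        rw [h2, zero_smul, sub_zero] at h1
        exact h1.symm
      · rintro ⟨⟨h1, h2⟩, h3⟩
        have := hpow x h2 0
        simpa [h1, h3] using this
    have h1 := finrank_inf_ker_add_one (LinearMap.ker (g - 1)) (B e) (x := f)
      (by simp [hgf]) (by rw [hef]; exact one_ne_zero)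
    have h2 := finrank_inf_ker_add_one (LinearMap.ker (g - 1) ⊓ LinearMap.ker (B e)) (B w)
      (x := ((g - 1) ^ m) (g w))
      ⟨by rw [SetLike.mem_coe, LinearMap.mem_ker, ← Module.End.mul_apply, ← pow_succ', hm1],
        horth _ (by rw [hegx, hew]) _⟩ hc
    rw [← hker] at h2
    have e1 := LinearMap.finrank_range_add_finrank_ker (g - 1)
    have e2 := LinearMap.finrank_range_add_finrank_ker (v - 1)
    have : Module.finrank k (LinearMap.range (v - 1)) =
      Module.finrank k (LinearMap.range (g - 1)) + 2 := by omega
    rw [this]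
    exact heven.add even_two
  · ext x
    rw [show m + 2 + 1 = (m + 2) + 1 from rfl, pow_succ', Module.End.mul_apply, hm2]
    simp [hve]
  · rintro x ⟨⟨hxU, hxe⟩, hxf⟩
    rw [hv, hgU x hxU, LinearMap.mem_ker.1 hxe, hwU x hxU]
    simp
  · rintro x ⟨_, hxf⟩
    exact LinearMap.mem_ker.1 hxf
  · rw [hm2, hvf, map_smul, hfe]
    simpa [hef, hee, hegx, hew] using hc

end RegularUnipotent

/-! ### The nilpotency index of a regular unipotent element -/

section RegularUnipotent

variable {k V : Type*} [Field k] [AddCommGroup V] [Module k V] {Q : QuadraticForm k V}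

/-- Away from characteristic two the identity starts the construction, witnessed by a non-singular
vector. -/
lemma hasUnipotentOrthogonalTo_of_two_ne_zero (h2 : (2 : k) ≠ 0) {U : Submodule k V} {e f : V}
    (hQe : Q e = 0) (hQf : Q f = 0) (hef : Q.polarBilin e f = 1) :
    HasUnipotentOrthogonalTo Q
      (U ⊓ LinearMap.ker (Q.polarBilin e) ⊓ LinearMap.ker (Q.polarBilin f)) 0 := by
  refine ⟨1, e + f, fun v => rfl, ?_, by simp, fun x _ => rfl, ?_, ?_⟩
  · rw [sub_self, LinearMap.range_zero, finrank_bot]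
    exact Even.zero
  · rintro x ⟨⟨_, hxe⟩, hxf⟩
    rw [map_add, LinearMap.add_apply, LinearMap.mem_ker.1 hxe, LinearMap.mem_ker.1 hxf, add_zero]
  · rw [pow_zero, Module.End.one_apply, Module.End.one_apply, polarBilin_self,
      map_add_polarBilin, hQe, hQf, hef]
    simpa using h2

/-- In characteristic two, the product of the reflections in two orthogonal non-singular vectors
starts the construction. -/
lemma hasUnipotentOrthogonalTo_of_two_eq_zero [FiniteDimensional k V] (h2 : (2 : k) = 0)
    {U : Submodule k V} {e f e' f' : V} (hQe : Q e = 0) (hQf : Q f = 0)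
    (hef : Q.polarBilin e f = 1)
    (he' : e' ∈ U ⊓ LinearMap.ker (Q.polarBilin e) ⊓ LinearMap.ker (Q.polarBilin f))
    (hf' : f' ∈ U ⊓ LinearMap.ker (Q.polarBilin e) ⊓ LinearMap.ker (Q.polarBilin f))
    (hQe' : Q e' = 0) (hQf' : Q f' = 0) (hef' : Q.polarBilin e' f' = 1) :
    HasUnipotentOrthogonalTo Q
      (U ⊓ LinearMap.ker (Q.polarBilin e) ⊓ LinearMap.ker (Q.polarBilin f) ⊓
        LinearMap.ker (Q.polarBilin e') ⊓ LinearMap.ker (Q.polarBilin f')) 1 := by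
  obtain ⟨⟨_, hee'⟩, hfe'⟩ := he'
  obtain ⟨⟨_, hef''⟩, hff'⟩ := hf'
  rw [SetLike.mem_coe, LinearMap.mem_ker] at hee' hfe' hef'' hff'
  set B := Q.polarBilin with hB
  have hsw : ∀ x y, B x y = B y x := polarBilin_swap Q
  have hself : ∀ x, B x x = 0 := fun x => by rw [hB, polarBilin_self, h2, zero_mul]
  obtain ⟨a, ha⟩ : ∃ a, a = e + f := ⟨_, rfl⟩
  obtain ⟨b, hb⟩ : ∃ b, b = e' + f' := ⟨_, rfl⟩
  have hQa : Q a = 1 := by rw [ha, map_add_polarBilin, hQe, hQf, ← hB, hef]; simp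
  have hQb : Q b = 1 := by rw [hb, map_add_polarBilin, hQe', hQf', ← hB, hef']; simp
  have hab : B a b = 0 := by simp [ha, hb, hee', hfe', hef'', hff']
  have hba : B b a = 0 := by rw [hsw, hab]
  have hae : B a e = 1 := by simp [ha, hself, hsw f e, hef]
  have hbe : B b e = 0 := by simp [hb, hsw _ e, hee', hef'']
  have hbe' : B b e' = 1 := by simp [hb, hself, hsw f' e', hef']
  have hae' : B a e' = 0 := by simp [ha, hee', hfe']
  obtain ⟨N, hN⟩ : ∃ N : Module.End k V, ∀ x, N x = B a x • a + B b x • b :=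
    ⟨(B a).smulRight a + (B b).smulRight b, fun x => by simp⟩
  have hNN : ∀ x, N (N x) = 0 := fun x => by simp [hN, hself, hab, hba]
  have hNe : N e = a := by simp [hN, hae, hbe]
  refine ⟨1 + N, e, ?_, ?_, ?_, ?_, ?_, ?_⟩
  · intro x
    rw [LinearMap.add_apply, Module.End.one_apply, map_add_polarBilin, hN, map_add_polarBilin,
      ← hB, QuadraticMap.map_smul, QuadraticMap.map_smul, hQa, hQb]
    simp only [map_add, map_smul, smul_eq_mul, LinearMap.smul_apply, hab, hsw x a, hsw x b]
    linear_combination (B a x * B a x + B b x * B b x) * h2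
  · rw [add_sub_cancel_left]
    have hker : LinearMap.ker N = ⊤ ⊓ LinearMap.ker (B a) ⊓ LinearMap.ker (B b) := by
      ext x
      simp only [Submodule.mem_inf, LinearMap.mem_ker, Submodule.mem_top, true_and]
      constructor
      · intro hx
        rw [hN] at hx
        constructor
        · simpa [hsw e, hae, hbe] using congrArg (B e) hx
        · simpa [hsw e', hae', hbe'] using congrArg (B e') hx
      · rintro ⟨h1, h2⟩
        rw [hN, h1, h2, zero_smul, zero_smul, add_zero]
    have h1 := finrank_inf_ker_add_one ⊤ (B a) (x := e) trivial (by rw [hae]; exact one_ne_zero)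
    have h2 := finrank_inf_ker_add_one (⊤ ⊓ LinearMap.ker (B a)) (B b) (x := e')
      ⟨trivial, hae'⟩ (by rw [hbe']; exact one_ne_zero)
    rw [finrank_top] at h1
    rw [← hker] at h2
    have e1 := LinearMap.finrank_range_add_finrank_ker N
    have : Module.finrank k (LinearMap.range N) = 2 := by omega
    rw [this]
    exact even_two
  · rw [add_sub_cancel_left]
    ext x
    simpa [pow_two] using hNN x
  · rintro x ⟨⟨⟨⟨_, h1⟩, h2⟩, h3⟩, h4⟩
    rw [SetLike.mem_coe, LinearMap.mem_ker] at h1 h2 h3 h4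
    simp [hN, ha, hb, h1, h2, h3, h4]
  · rintro x ⟨⟨⟨⟨_, h1⟩, _⟩, _⟩, _⟩
    exact h1
  · rw [add_sub_cancel_left, pow_one, LinearMap.add_apply, map_add, hNN, Module.End.one_apply,
      hNe, add_zero, hsw, hae]
    exact one_ne_zero

section RegularFunctions

variable {A : Type*} [Ring A] [Algebra k A] [FiniteDimensional k A]

/-- The `A`-valued functions on `Aˣ` with regular coordinates are closed under multiplication. -/
lemma mul_mem_regularFunctions {F G : Aˣ → A}
    (hF : ∀ φ : Module.Dual k A, (fun g => φ (F g)) ∈ regularFunctions k A)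
    (hG : ∀ φ : Module.Dual k A, (fun g => φ (G g)) ∈ regularFunctions k A)
    (φ : Module.Dual k A) : (fun g => φ (F g * G g)) ∈ regularFunctions k A := by
  let b := Module.finBasis k A
  have h : (fun g => φ (F g * G g)) = ∑ i, ∑ j,
      φ (b i * b j) • ((fun g => b.coord i (F g)) * fun g => b.coord j (G g)) := by
    funext g
    conv_lhs => rw [← b.sum_repr (F g), ← b.sum_repr (G g), Finset.sum_mul_sum]
    simp only [map_sum, Finset.sum_apply, Pi.smul_apply, Pi.mul_apply, smul_mul_smul_comm, map_smul,
      smul_eq_mul, Module.Basis.coord_apply]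
    exact Finset.sum_congr rfl fun i _ => Finset.sum_congr rfl fun j _ => mul_comm _ _
  rw [h]
  exact sum_mem fun i _ => sum_mem fun j _ =>
    Subalgebra.smul_mem _ (mul_mem (hF _) (hG _)) _

lemma sub_one_pow_mem_regularFunctions (m : ℕ) (φ : Module.Dual k A) :
    (fun g : Aˣ => φ (((g : A) - 1) ^ m)) ∈ regularFunctions k A := by
  have hconst : ∀ c : k, (fun _ : Aˣ => c) ∈ regularFunctions k A :=
    fun c => Subalgebra.algebraMap_mem _ c
  induction m generalizing φ with
  | zero => simpa using hconst (φ 1)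
  | succ m ih =>
    simp only [pow_succ]
    refine mul_mem_regularFunctions ih (fun ψ => ?_) φ
    simp only [map_sub]
    exact sub_mem (Algebra.subset_adjoin (Or.inl ⟨ψ, rfl⟩)) (hconst (ψ 1))

end RegularFunctions

variable [IsAlgClosed k] [FiniteDimensional k V]

lemma HasUnipotentOrthogonalTo.iterate (j : ℕ) {U : Submodule k V} {m : ℕ}
    (h : HasUnipotentOrthogonalTo Q U m) (hU : NondegenerateOn Q U)
    (hj : 2 * j ≤ Module.finrank k U) :
    ∃ U', HasUnipotentOrthogonalTo Q U' (m + 2 * j) := by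
  induction j generalizing U m with
  | zero => exact ⟨U, h⟩
  | succ j ih =>
    obtain ⟨e, he, f, hf, hQe, hQf, hef⟩ := exists_hyperbolic_pair hU (by omega)
    have h1 := finrank_orthogonal_hyperbolic_pair he hf hQe hef
    obtain ⟨U', hU'⟩ := ih (h.step he hf hQe hef) (hU.orthogonal he hf hQe hQf hef) (by omega)
    exact ⟨U', by rwa [show m + 2 * (j + 1) = m + 2 + 2 * j by ring]⟩

/-- A space of dimension `2 * l` has an element of the special orthogonal group that is unipotent
with a Jordan block of size at least `2 * l - 2`. -/
lemma exists_isUnipotent_pow_ne_zero (hQ : Q.polarBilin.Nondegenerate) {l : ℕ} (hl : 2 ≤ l)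
    (hV : Module.finrank k V = 2 * l) :
    ∃ v ∈ specialOrthogonal Q, IsUnipotent v ∧
      ((v : Module.End k V) - 1) ^ (2 * l - 3) ≠ 0 := by
  have hT : NondegenerateOn Q ⊤ := fun x _ hx => by
    by_contra! h
    exact hx (hQ.1 x fun y => h y trivial)
  obtain ⟨e, he, f, hf, hQe, hQf, hef⟩ := exists_hyperbolic_pair hT (by rw [finrank_top]; omega)
  have hd := finrank_orthogonal_hyperbolic_pair he hf hQe hef
  have hU := hT.orthogonal he hf hQe hQf hef
  rw [finrank_top] at hd
  obtain ⟨U, m, hm, g, w, hg, heven, hnil, -, -, hc⟩ :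
      ∃ U m, 2 * l - 3 ≤ m ∧ HasUnipotentOrthogonalTo Q U m := by
    by_cases h2 : (2 : k) = 0
    · obtain ⟨e', he', f', hf', hQe', hQf', hef'⟩ := exists_hyperbolic_pair hU (by omega)
      have hd' := finrank_orthogonal_hyperbolic_pair he' hf' hQe' hef'
      obtain ⟨U, hU'⟩ := HasUnipotentOrthogonalTo.iterate (l - 2)
        (hasUnipotentOrthogonalTo_of_two_eq_zero h2 hQe hQf hef he' hf' hQe' hQf' hef')
        (hU.orthogonal he' hf' hQe' hQf' hef') (by omega)
      exact ⟨U, _, by omega, hU'⟩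
    · obtain ⟨U, hU'⟩ := HasUnipotentOrthogonalTo.iterate (l - 1)
        (hasUnipotentOrthogonalTo_of_two_ne_zero (U := ⊤) h2 hQe hQf hef) hU (by omega)
      exact ⟨U, _, by omega, hU'⟩
  have hunit : IsUnit g := by
    rw [← sub_add_cancel g 1]
    exact IsNilpotent.isUnit_add_one ⟨m + 1, hnil⟩
  obtain ⟨v, rfl⟩ := hunit
  refine ⟨v, ⟨hg, heven⟩, ⟨m + 1, hnil⟩, fun h => hc ?_⟩
  rw [pow_eq_zero_of_le hm h]
  simp

/-- The vanishing of `(g - 1) ^ m` is a Zariski closed condition that is invariant under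
conjugation, so that a regular unipotent element inherits the large Jordan block of some unipotent
element. -/
lemma IsRegularUnipotent.sub_one_pow_ne_zero (hQ : Q.polarBilin.Nondegenerate) {l : ℕ}
    (hl : 2 ≤ l) (hV : Module.finrank k V = 2 * l) {u : (Module.End k V)ˣ}
    (hu : IsRegularUnipotent Q u) : ((u : Module.End k V) - 1) ^ (2 * l - 3) ≠ 0 := by
  intro h0
  obtain ⟨v, hv, hvu, hne⟩ := exists_isUnipotent_pow_ne_zero hQ hl hV
  apply hne
  rw [← Module.forall_dual_apply_eq_zero_iff k]
  intro φ
  refine hu.2.2 ⟨hv, hvu⟩ _ (sub_one_pow_mem_regularFunctions (2 * l - 3) φ) ?_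
  rintro _ ⟨h, -, rfl⟩
  have h1 : (((h * u * h⁻¹ : (Module.End k V)ˣ) : Module.End k V) - 1) =
      (h : Module.End k V) * ((u : Module.End k V) - 1) *
        ((h⁻¹ : (Module.End k V)ˣ) : Module.End k V) := by
    simp [mul_sub, sub_mul]
  rw [h1, Units.conj_pow, h0]
  simp

end RegularUnipotent

/-! ### A unipotent map permuting the summands of a decomposition -/

section Decomposition

variable {k V : Type*} [Field k] [AddCommGroup V] [Module k V]

lemma exists_mem_ker_of_isNilpotent {X : Module.End k V} (hX : IsNilpotent X) {P : Submodule k V}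
    (hP : P ≠ ⊥) (hXP : ∀ x ∈ P, X x ∈ P) : ∃ v ∈ P, v ≠ 0 ∧ X v = 0 := by
  obtain ⟨w, hwP, hw⟩ := P.ne_bot_iff.1 hP
  obtain ⟨N, hN⟩ := hX
  have hex : ∃ n, (X ^ n) w = 0 := ⟨N, by simp [hN]⟩
  classical
  obtain ⟨q, hq⟩ : ∃ q, Nat.find hex = q + 1 :=
    Nat.exists_eq_succ_of_ne_zero fun h => hw (by
      have h1 := Nat.find_spec hex
      rw [h] at h1
      simpa using h1)
  have hmem : ∀ n, (X ^ n) w ∈ P := fun n => by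
    induction n with
    | zero => simpa using hwP
    | succ n ih => rw [pow_succ', Module.End.mul_apply]; exact hXP _ ih
  refine ⟨(X ^ q) w, hmem q, Nat.find_min hex (by omega), ?_⟩
  rw [← Module.End.mul_apply, ← pow_succ', ← hq]
  exact Nat.find_spec hex

lemma pow_finrank_apply_of_isNilpotent [FiniteDimensional k V] {X : Module.End k V}
    (hX : IsNilpotent X) {P : Submodule k V} (hXP : ∀ x ∈ P, X x ∈ P) {x : V} (hx : x ∈ P) :
    (X ^ Module.finrank k P) x = 0 := by
  obtain ⟨N, hN⟩ := hX
  have h1 := Module.End.ker_pow_le_ker_pow_finrank (X.restrict hXP) N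
  have h2 : (⟨x, hx⟩ : P) ∈ LinearMap.ker (X.restrict hXP ^ N) := by
    rw [LinearMap.mem_ker, Module.End.pow_restrict N]
    exact Subtype.ext (by simp [LinearMap.restrict_apply, hN])
  have h3 := h1 h2
  rw [LinearMap.mem_ker, Module.End.pow_restrict] at h3
  simpa [LinearMap.restrict_apply] using congrArg Subtype.val h3

lemma finrank_finset_sup_le [FiniteDimensional k V] {Ω : Type*} (W : Ω → Submodule k V)
    (S : Finset Ω) : Module.finrank k ↥(S.sup W) ≤ ∑ i ∈ S, Module.finrank k (W i) := by
  classical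
  induction S using Finset.induction_on with
  | empty => simp
  | insert i S hi ih =>
    rw [Finset.sup_insert, Finset.sum_insert hi]
    exact (Submodule.finrank_add_le_finrank_add_finrank _ _).trans (by omega)

variable {u : (Module.End k V)ˣ}

lemma IsUnipotent.isNilpotent_pow_sub_one (hu : IsUnipotent u) (n : ℕ) :
    IsNilpotent ((u : Module.End k V) ^ n - 1) := by
  rw [← mul_geom_sum]
  refine Commute.isNilpotent_mul_right ?_ hu
  exact (Commute.sum_right _ _ _ fun i _ => Commute.pow_right (Commute.refl _) i).sub_left
    (Commute.one_left _)

section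

variable {Ω : Type*} {W : Ω → Submodule k V} {σ : Equiv.Perm Ω}

lemma pow_apply_mem (hσ : ∀ i, (W i).map (u : Module.End k V) = W (σ i)) (n : ℕ) {i : Ω} {x : V}
    (hx : x ∈ W i) : ((u : Module.End k V) ^ n) x ∈ W ((σ ^ n) i) := by
  induction n with
  | zero => simpa using hx
  | succ n ih =>
    rw [pow_succ' (u : Module.End k V), Module.End.mul_apply, pow_succ' σ, Equiv.Perm.mul_apply,
      ← hσ]
    exact Submodule.mem_map_of_mem ih

lemma map_zpow_eq (hσ : ∀ i, (W i).map (u : Module.End k V) = W (σ i)) (n : ℤ) (i : Ω) :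
    (W i).map ((u ^ n : (Module.End k V)ˣ) : Module.End k V) = W ((σ ^ n) i) := by
  have hmul : ∀ (a b : (Module.End k V)ˣ) (P : Submodule k V),
      P.map ((a * b : (Module.End k V)ˣ) : Module.End k V) =
        (P.map (b : Module.End k V)).map (a : Module.End k V) := fun a b P => by
    rw [Units.val_mul, Module.End.mul_eq_comp, Submodule.map_comp]
  have hinv : ∀ j, (W (σ j)).map ((u⁻¹ : (Module.End k V)ˣ) : Module.End k V) = W j := fun j => by
    rw [← hσ, ← hmul, inv_mul_cancel]
    exact Submodule.map_id _
  induction n with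
  | zero => exact Submodule.map_id (W i)
  | succ n ih => rw [zpow_add_one, zpow_add_one, (Commute.self_zpow u _).symm.eq, hmul, ih, hσ,
      (Commute.self_zpow σ _).symm.eq, Equiv.Perm.mul_apply]
  | pred n ih =>
    rw [zpow_sub_one, zpow_sub_one, (Commute.self_zpow u _).inv_left.symm.eq, hmul, ih,
      (Commute.self_zpow σ _).inv_left.symm.eq, Equiv.Perm.mul_apply, ← hinv (σ⁻¹ _)]
    simp

lemma finrank_map_unit (P : Submodule k V) :
    Module.finrank k ↥(P.map (u : Module.End k V)) = Module.finrank k P := by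
  have hinj : Function.Injective (u : Module.End k V) :=
    ((Module.End.isUnit_iff _).1 u.isUnit).1
  exact (LinearEquiv.finrank_eq (Submodule.equivMapOfInjective _ hinj P)).symm

lemma finrank_eq_of_sameCycle (hσ : ∀ i, (W i).map (u : Module.End k V) = W (σ i)) {i j : Ω}
    (h : σ.SameCycle i j) : Module.finrank k (W j) = Module.finrank k (W i) := by
  obtain ⟨n, rfl⟩ := h
  rw [← map_zpow_eq hσ, finrank_map_unit]

end

variable {Ω : Type*} [DecidableEq Ω] {W : Ω → Submodule k V} {σ : Equiv.Perm Ω}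

/-- In characteristic two the orbits of a unipotent element on the pieces have `2`-power size,
because the element itself has `2`-power order. -/
lemma exists_card_eq_two_pow (h2 : (2 : k) = 0) (hu : IsUnipotent u)
    (hW : DirectSum.IsInternal W) (hne : ∀ i, W i ≠ ⊥)
    (hσ : ∀ i, (W i).map (u : Module.End k V) = W (σ i)) {C : Finset Ω} (hC : σ.IsCycleOn C)
    {a : Ω} (ha : a ∈ C) : ∃ s, C.card = 2 ^ s := by
  have : CharP k 2 := CharTwo.of_one_ne_zero_of_two_eq_zero one_ne_zero h2
  have : Nontrivial V := by
    obtain ⟨x, -, hx⟩ := (W a).ne_bot_iff.1 (hne a)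
    exact ⟨x, 0, hx⟩
  have : CharP (Module.End k V) 2 := charP_of_injective_algebraMap' k 2
  obtain ⟨N, hN⟩ := hu
  have h1 : (u : Module.End k V) ^ 2 ^ N = 1 := by
    have h3 := sub_pow_char_pow_of_commute (R := Module.End k V) (p := 2) (n := N)
      (Commute.one_right (u : Module.End k V))
    rw [one_pow, pow_eq_zero_of_le Nat.lt_two_pow_self.le hN] at h3
    exact (sub_eq_zero.1 h3.symm)
  have h4 : (σ ^ 2 ^ N) a = a := by
    apply hW.submodule_iSupIndep.injective hne
    have := map_zpow_eq hσ ((2 ^ N : ℕ) : ℤ) a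
    rw [zpow_natCast, zpow_natCast, Units.val_pow_eq_pow_val, h1] at this
    rw [← this]
    exact Submodule.map_id _
  rw [hC.pow_apply_eq ha] at h4
  obtain ⟨s, -, hs⟩ := (Nat.dvd_prime_pow Nat.prime_two).1 h4
  exact ⟨s, hs⟩

variable [Fintype Ω]

/-- The projections onto the summands of a direct sum decomposition. -/
lemma exists_projections (hW : DirectSum.IsInternal W) : ∃ π : Ω → Module.End k V,
    (∀ i x, π i x ∈ W i) ∧ (∀ x, ∑ i, π i x = x) ∧ (∀ i, ∀ x ∈ W i, π i x = x) ∧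
    ∀ i j, i ≠ j → ∀ x ∈ W i, π j x = 0 := by
  let e := LinearEquiv.ofBijective (DirectSum.coeLinearMap W) hW
  have he : ∀ i (x : W i), e.symm x = DirectSum.lof k Ω (fun i => W i) i x := fun i x => by
    rw [LinearEquiv.symm_apply_eq]
    exact (DirectSum.coeLinearMap_lof W i x).symm
  obtain ⟨π, hπ⟩ : ∃ π : Ω → Module.End k V, ∀ i x, π i x = (e.symm x i : V) :=
    ⟨fun i => (W i).subtype ∘ₗ DirectSum.component k Ω (fun i => W i) i ∘ₗ
      (e.symm : V →ₗ[k] _), fun i x => rfl⟩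
  have h1 : ∀ i, ∀ x ∈ W i, π i x = x := fun i x hx => by
    rw [hπ, he i ⟨x, hx⟩]
    exact congrArg Subtype.val 
      (DirectSum.component.lof_self k (M := fun i => W i) i (⟨x, hx⟩ : W i))
  have h2 : ∀ i j, i ≠ j → ∀ x ∈ W i, π j x = 0 := fun i j hij x hx => by
    rw [hπ, he i ⟨x, hx⟩]
    have := DirectSum.component.of (R := k) (M := fun i => W i) j i ⟨x, hx⟩
    rw [dif_neg hij] at this
    exact congrArg Subtype.val this
  refine ⟨π, fun i x => by rw [hπ]; exact Subtype.mem _, fun x => ?_, h1, h2⟩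
  have hx : x ∈ ⨆ i, W i := by rw [hW.submodule_iSup_eq_top]; trivial
  induction hx using Submodule.iSup_induction' with
  | mem i x hx =>
    rw [Finset.sum_eq_single i (fun j _ hj => h2 i j hj.symm x hx) (by simp), h1 i x hx]
  | zero => simp
  | add x y _ _ hx hy => simp_rw [map_add, Finset.sum_add_distrib, hx, hy]

lemma sum_finrank_eq [FiniteDimensional k V] (hW : DirectSum.IsInternal W) :
    ∑ i, Module.finrank k (W i) = Module.finrank k V := by
  rw [← LinearEquiv.finrank_eq (LinearEquiv.ofBijective (DirectSum.coeLinearMap W) hW),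
    Module.finrank_directSum]

/-- Away from characteristic two the orbits of a unipotent element on the pieces have odd size: an
orbit of even size carries an eigenvector for the eigenvalue `-1`. -/
lemma odd_card_of_two_ne_zero (h2 : (2 : k) ≠ 0) (hu : IsUnipotent u)
    (hW : DirectSum.IsInternal W) (hne : ∀ i, W i ≠ ⊥)
    (hσ : ∀ i, (W i).map (u : Module.End k V) = W (σ i)) {C : Finset Ω} (hC : σ.IsCycleOn C)
    {a : Ω} (ha : a ∈ C) : Odd C.card := by
  by_contra heven
  rw [Nat.not_odd_iff_even] at heven
  set n := C.card with hn
  have hn0 : n ≠ 0 := Finset.card_ne_zero_of_mem ha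
  have hWa : ∀ x ∈ W a, ((u : Module.End k V) ^ n - 1) x ∈ W a := fun x hx => by
    have := pow_apply_mem hσ n hx
    rw [hC.pow_card_apply ha] at this
    exact (W a).sub_mem this hx
  obtain ⟨v, hv, hv0, hvu⟩ := exists_mem_ker_of_isNilpotent (hu.isNilpotent_pow_sub_one n)
    (hne a) hWa
  -- with `u ^ n v = v`, the alternating sum of the `u ^ i v` is an eigenvector for `-1`
  obtain ⟨s, hs⟩ : ∃ s, s = (∑ i ∈ Finset.range n, (-(u : Module.End k V)) ^ i) v := ⟨_, rfl⟩
  have hus : (u : Module.End k V) s = -s := by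
    have h1 := congrArg (fun f : Module.End k V => f v) (mul_neg_geom_sum (-(u : Module.End k V)) n)
    simp only [heven.neg_pow, Module.End.mul_apply, ← hs] at h1
    rw [← neg_sub ((u : Module.End k V) ^ n), LinearMap.neg_apply, hvu, neg_zero] at h1
    rw [sub_neg_eq_add, LinearMap.add_apply, Module.End.one_apply] at h1
    exact eq_neg_of_add_eq_zero_right h1
  have hs0 : s = 0 := by
    obtain ⟨N, hN⟩ := hu
    have h1 : ∀ m, (((u : Module.End k V) - 1) ^ m) s = (-2 : k) ^ m • s := by
      intro m
      induction m with
      | zero => simp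
      | succ m ih =>
        rw [pow_succ', Module.End.mul_apply, ih, map_smul, LinearMap.sub_apply, hus,
          Module.End.one_apply, pow_succ]
        module
    have h3 := h1 N
    rw [hN, LinearMap.zero_apply] at h3
    exact (smul_eq_zero.1 h3.symm).resolve_left (pow_ne_zero _ (neg_ne_zero.2 h2))
  obtain ⟨π, -, -, hπ1, hπ2⟩ := exists_projections hW
  apply hv0
  have h4 : π a s = v := by
    rw [hs, LinearMap.sum_apply, map_sum, Finset.sum_eq_single 0]
    · simpa using hπ1 a v hv
    · intro i hi hi0
      rw [neg_pow, Module.End.mul_apply]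
      refine hπ2 ((σ ^ i) a) a (fun h => ?_) _ ?_
      · rw [hC.pow_apply_eq ha] at h
        exact absurd (Nat.le_of_dvd (Nat.pos_of_ne_zero hi0) h)
          (not_le.2 (Finset.mem_range.1 hi))
      · have := pow_apply_mem hσ i hv
        rcases neg_one_pow_eq_or (Module.End k V) i with h | h <;> rw [h]
        · exact this
        · simpa using this
    · intro h
      exact absurd (Finset.mem_range.2 (Nat.pos_of_ne_zero hn0)) h
  rw [← h4, hs0, map_zero]

/-- If `u` permutes the pieces transitively, a fixed vector of `u` is determined by its component in
any piece. -/
lemma finrank_ker_le_of_isCycleOn [FiniteDimensional k V] (hW : DirectSum.IsInternal W)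
    (hσ : ∀ i, (W i).map (u : Module.End k V) = W (σ i)) {a : Ω} (hC : ∀ b, σ.SameCycle a b)
    {n : ℕ} (hn : (σ ^ n) a = a) :
    Module.finrank k (LinearMap.ker ((u : Module.End k V) - 1)) ≤
      Module.finrank k ↥(W a ⊓ LinearMap.ker ((u : Module.End k V) ^ n - 1)) := by
  obtain ⟨π, hπW, hπs, hπ1, hπ2⟩ := exists_projections hW
  have hcomm : ∀ i x, (u : Module.End k V) (π i x) = π (σ i) ((u : Module.End k V) x) := by
    intro i x
    have hmem : ∀ j, (u : Module.End k V) (π j x) ∈ W (σ j) := fun j =>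
      hσ j ▸ Submodule.mem_map_of_mem (hπW j x)
    conv_rhs => rw [← hπs x, map_sum, map_sum]
    rw [Finset.sum_eq_single i]
    · exact (hπ1 _ _ (hmem i)).symm
    · exact fun j _ hj => hπ2 _ _ (fun h => hj (σ.injective h)) _ (hmem j)
    · simp
  have hpow : ∀ x, (u : Module.End k V) x = x → ∀ m : ℕ,
      ((u : Module.End k V) ^ m) (π a x) = π ((σ ^ m) a) x := by
    intro x hx m
    induction m with
    | zero => simp
    | succ m ih =>
      rw [pow_succ', Module.End.mul_apply, ih, hcomm, hx, pow_succ', Equiv.Perm.mul_apply]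
  have hux : ∀ x ∈ LinearMap.ker ((u : Module.End k V) - 1), (u : Module.End k V) x = x :=
    fun x hx => sub_eq_zero.1 hx
  have hmaps : ∀ x ∈ LinearMap.ker ((u : Module.End k V) - 1),
      π a x ∈ W a ⊓ LinearMap.ker ((u : Module.End k V) ^ n - 1) := by
    intro x hx
    refine ⟨hπW a x, ?_⟩
    rw [SetLike.mem_coe, LinearMap.mem_ker, LinearMap.sub_apply, hpow x (hux x hx), hn,
      Module.End.one_apply, sub_self]
  refine LinearMap.finrank_le_finrank_of_injective (f := (π a).restrict hmaps) ?_
  rw [injective_iff_map_eq_zero]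
  rintro ⟨x, hx⟩ h
  have h0 : π a x = 0 := congrArg Subtype.val h
  refine Subtype.ext (a1 := ⟨x, hx⟩) (a2 := 0) ?_
  change x = 0
  rw [← hπs x]
  refine Finset.sum_eq_zero fun b _ => ?_
  obtain ⟨m, rfl⟩ := (hC b).exists_nat_pow_eq
  rw [← hpow x (hux x hx), h0, map_zero]

end Decomposition

/-! ### The orbits of the summands -/

section Orbits

variable {k V : Type*} [Field k] [AddCommGroup V] [Module k V]

section

variable {Ω : Type*} {W : Ω → Submodule k V} {u : (Module.End k V)ˣ} {σ : Equiv.Perm Ω}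

lemma sub_one_apply_mem_sup (hσ : ∀ i, (W i).map (u : Module.End k V) = W (σ i)) {C : Finset Ω}
    (hC : ∀ i ∈ C, σ i ∈ C) : ∀ x ∈ C.sup W, ((u : Module.End k V) - 1) x ∈ C.sup W := by
  intro x hx
  refine (C.sup W).sub_mem ?_ hx
  have h1 : (C.sup W).map (u : Module.End k V) ≤ C.sup W := by
    rw [Finset.sup_eq_iSup, Submodule.map_iSup, iSup_le_iff]
    intro i
    rw [Submodule.map_iSup, iSup_le_iff]
    intro hi
    rw [hσ, ← Finset.sup_eq_iSup]
    exact Finset.le_sup (f := W) (hC i hi)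
  exact h1 (Submodule.mem_map_of_mem hx)

lemma isCycleOn_sameCycle [Fintype Ω] [DecidableRel σ.SameCycle] (a : Ω) :
    σ.IsCycleOn (Finset.univ.filter fun b => σ.SameCycle a b : Finset Ω) := by
  refine ⟨⟨fun b hb => ?_, σ.injective.injOn, fun b hb => ⟨σ⁻¹ b, ?_, by simp⟩⟩, ?_⟩
  · simpa using hb
  · simpa using hb
  · intro x hx y hy
    simp only [Finset.coe_filter, Finset.mem_univ, true_and, Set.mem_ofPred_eq] at hx hy
    exact hx.symm.trans hy

lemma isCycleOn_pair [DecidableEq Ω] {b c : Ω} (hbc : σ b = c) (hcb : σ c = b) :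
    σ.IsCycleOn (({b, c} : Finset Ω) : Set Ω) := by
  refine ⟨⟨?_, σ.injective.injOn, ?_⟩, ?_⟩
  · intro i hi
    rcases (by simpa using hi : i = b ∨ i = c) with rfl | rfl <;> simp [hbc, hcb]
  · intro i hi
    rcases (by simpa using hi : i = b ∨ i = c) with rfl | rfl
    · exact ⟨c, by simp, hcb⟩
    · exact ⟨b, by simp, hbc⟩
  · have h1 : σ.SameCycle b c := ⟨1, by simpa using hbc⟩
    intro i hi j hj
    rw [Finset.mem_coe, Finset.mem_insert, Finset.mem_singleton] at hi hj
    rcases hi with hi | hi <;> rcases hj with hj | hj <;> rw [hi, hj]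
    exacts [h1, h1.symm]

lemma exists_fixedPoint_of_odd_card {C : Finset Ω} (hC : Odd C.card) {ν : Ω → Ω}
    (hν : Function.Involutive ν) (hνC : ∀ i ∈ C, ν i ∈ C) : ∃ c ∈ C, ν c = c := by
  have hinv : Function.Involutive fun c : C => (⟨ν c, hνC c c.2⟩ : C) :=
    fun c => Subtype.ext (hν c)
  obtain ⟨c, hc⟩ := Equiv.Perm.exists_fixed_point_of_prime (p := 2) (n := 1)
    (σ := hinv.toPerm _) (by rw [Fintype.card_coe]; exact Odd.not_two_dvd_nat hC)
    (Equiv.ext fun c => by simpa [pow_two] using hinv c)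
  exact ⟨c, c.2, congrArg Subtype.val hc⟩

end

variable [FiniteDimensional k V]

/-- On an invariant subspace, a large kernel forces a small nilpotency index. -/
lemma pow_apply_eq_zero_of_finrank_lt {X : Module.End k V} (hX : IsNilpotent X)
    {P : Submodule k V} (hXP : ∀ x ∈ P, X x ∈ P) {j : ℕ}
    (hj : Module.finrank k P < Module.finrank k ↥(P ⊓ LinearMap.ker X) + j) {x : V}
    (hx : x ∈ P) : (X ^ j) x = 0 := by
  have hnil : IsNilpotent (X.restrict hXP) := by
    obtain ⟨N, hN⟩ := hX
    refine ⟨N, ?_⟩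
    rw [Module.End.pow_restrict N]
    exact LinearMap.ext fun y => Subtype.ext (by simp [LinearMap.restrict_apply, hN])
  have hker : P ⊓ LinearMap.ker X = (LinearMap.ker (X.restrict hXP)).map P.subtype := by
    ext y
    simp [LinearMap.restrict_apply, and_comm]
  have hpow : X.restrict hXP ^ j = 0 := by
    by_contra h
    have h1 := finrank_ker_add_le_of_pow_ne_zero hnil h
    rw [hker, ← LinearEquiv.finrank_eq
      (Submodule.equivSubtypeMap P (LinearMap.ker (X.restrict hXP)))] at hj
    omega
  rw [Module.End.pow_restrict j] at hpow
  simpa [LinearMap.restrict_apply] using congrArg Subtype.val (LinearMap.congr_fun hpow ⟨x, hx⟩)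

lemma two_le_finrank_ker {u : (Module.End k V)ˣ} (hu : IsUnipotent u) {P : Submodule k V}
    (hP : P ≠ ⊥) (hker : Even (Module.finrank k (LinearMap.ker ((u : Module.End k V) - 1)))) :
    2 ≤ Module.finrank k (LinearMap.ker ((u : Module.End k V) - 1)) := by
  have : Module.finrank k (LinearMap.ker ((u : Module.End k V) - 1)) ≠ 0 := fun h => by
    obtain ⟨x, -, hx0, hx⟩ := exists_mem_ker_of_isNilpotent hu (P := ⊤)
      (fun h => hP (eq_bot_iff.2 (h ▸ le_top))) fun _ _ => trivial
    have hx' : x ∈ LinearMap.ker ((u : Module.End k V) - 1) := hx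
    rw [Submodule.finrank_eq_zero.1 h, Submodule.mem_bot] at hx'
    exact hx0 hx'
  obtain ⟨r, hr⟩ := hker
  omega

variable {Ω : Type*} [Fintype Ω] [DecidableEq Ω] {W : Ω → Submodule k V}
  {u : (Module.End k V)ˣ} {σ : Equiv.Perm Ω}

/-- The large Jordan block of `u` lives on a single orbit of pieces. -/
lemma exists_large_orbit (hu : IsUnipotent u) (hW : DirectSum.IsInternal W)
    (hσ : ∀ i, (W i).map (u : Module.End k V) = W (σ i)) {m : ℕ}
    (hm : ((u : Module.End k V) - 1) ^ m ≠ 0) :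
    ∃ (C : Finset Ω) (a : Ω), a ∈ C ∧ σ.IsCycleOn C ∧ m < ∑ i ∈ C, Module.finrank k (W i) := by
  classical
  by_contra! h
  apply hm
  ext x
  have hx : x ∈ ⨆ i, W i := by rw [hW.submodule_iSup_eq_top]; trivial
  rw [LinearMap.zero_apply]
  induction hx using Submodule.iSup_induction' with
  | mem a x hx =>
    have hC := isCycleOn_sameCycle (σ := σ) a
    set C := Finset.univ.filter fun b => σ.SameCycle a b with hCdef
    have ha : a ∈ C := by simpa [hCdef] using Equiv.Perm.SameCycle.refl σ a
    have h1 := h C a ha hC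
    have h2 := pow_finrank_apply_of_isNilpotent (P := C.sup W) hu
      (sub_one_apply_mem_sup hσ fun i hi => hC.apply_mem_iff.2 hi) (Finset.le_sup (f := W) ha hx)
    obtain ⟨d, hd⟩ := Nat.exists_eq_add_of_le ((finrank_finset_sup_le W C).trans h1)
    rw [hd, add_comm, pow_add, Module.End.mul_apply, h2, map_zero]
  | zero => simp
  | add x y _ _ hx hy => rw [map_add, hx, hy, add_zero]

/-- A single orbit in characteristic two has at most two pieces: `(u - 1) ^ n = u ^ n - 1` has a
kernel of dimension at least two on each of the `n` pieces, which bounds its nilpotency index. -/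
lemma card_le_two_of_single_orbit (h2 : (2 : k) = 0) (hu : IsUnipotent u)
    (hW : DirectSum.IsInternal W) (hne : ∀ i, W i ≠ ⊥)
    (hσ : ∀ i, (W i).map (u : Module.End k V) = W (σ i)) {C : Finset Ω} (hC : σ.IsCycleOn C)
    (hall : ∀ i, i ∈ C) {a : Ω} {m : ℕ} (hm : ((u : Module.End k V) - 1) ^ m ≠ 0)
    (hdim : ∑ i ∈ C, Module.finrank k (W i) ≤ m + 3)
    (hker : 2 ≤ Module.finrank k (LinearMap.ker ((u : Module.End k V) - 1))) : C.card ≤ 2 := by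
  obtain ⟨s, hs⟩ := exists_card_eq_two_pow h2 hu hW hne hσ hC (hall a)
  have : CharP k 2 := CharTwo.of_one_ne_zero_of_two_eq_zero one_ne_zero h2
  have : Nontrivial V := by
    obtain ⟨x, -, hx⟩ := (W a).ne_bot_iff.1 (hne a)
    exact ⟨x, 0, hx⟩
  have : CharP (Module.End k V) 2 := charP_of_injective_algebraMap' k 2
  set n := C.card with hn
  have hcyc : ∀ b, σ.SameCycle a b := fun b => hC.2 (hall a) (hall b)
  have hXn : ((u : Module.End k V) - 1) ^ n = (u : Module.End k V) ^ n - 1 := by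
    rw [hs, sub_pow_char_pow_of_commute (R := Module.End k V) (p := 2) (n := s)
      (Commute.one_right _), one_pow]
  have hna : (σ ^ n) a = a := hC.pow_card_apply (hall a)
  have h1 := hker.trans (finrank_ker_le_of_isCycleOn hW hσ hcyc hna)
  have hstab : ∀ x ∈ W a, ((u : Module.End k V) ^ n - 1) x ∈ W a := fun x hx => by
    have := pow_apply_mem hσ n hx
    rw [hna] at this
    exact (W a).sub_mem this hx
  obtain ⟨d, hd⟩ : ∃ d, Module.finrank k (W a) = d + 1 :=
    Nat.exists_eq_succ_of_ne_zero fun h => hne a (Submodule.finrank_eq_zero.1 h)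
  have h3 : ∀ x ∈ W a, (((u : Module.End k V) - 1) ^ (n * d)) x = 0 := fun x hx => by
    rw [pow_mul, hXn]
    exact pow_apply_eq_zero_of_finrank_lt (hu.isNilpotent_pow_sub_one n) hstab (by omega) hx
  have h4 : ((u : Module.End k V) - 1) ^ (n * d) = 0 := by
    ext x
    have hx : x ∈ ⨆ i, W i := by rw [hW.submodule_iSup_eq_top]; trivial
    rw [LinearMap.zero_apply]
    induction hx using Submodule.iSup_induction' with
    | mem b x hx =>
      obtain ⟨i, rfl⟩ := hcyc b
      rw [← map_zpow_eq hσ] at hx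
      obtain ⟨y, hy, rfl⟩ := hx
      have hcomm : Commute ((u : Module.End k V) - 1)
          ((u ^ i : (Module.End k V)ˣ) : Module.End k V) := by
        refine Commute.sub_left ?_ (Commute.one_left _)
        exact ((Commute.self_zpow u i).map (Units.coeHom (Module.End k V)))
      rw [← Module.End.mul_apply, (hcomm.pow_left _).eq, Module.End.mul_apply, h3 y hy, map_zero]
    | zero => simp
    | add x y _ _ hx hy => rw [map_add, hx, hy, add_zero]
  have h5 : m < n * d := by
    by_contra! hlt
    exact hm (pow_eq_zero_of_le hlt h4)
  have h6 : ∑ i ∈ C, Module.finrank k (W i) = n * (d + 1) := by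
    rw [Finset.sum_congr rfl fun i _ => (finrank_eq_of_sameCycle hσ (hcyc i)).trans hd,
      Finset.sum_const, smul_eq_mul]
  rw [h6, mul_add] at hdim
  omega

/-- The combinatorial core. The pieces of a decomposition of a `2 * l`-dimensional space are
permuted by a unipotent element `u` with a Jordan block of size at least `2 * l - 2`, compatibly
with a duality `ν` of the pieces that has at most one fixed point. Since the large block occupies
one `ν`-stable orbit, at most two dimensions are left for the others. -/
theorem orbit_classification (hu : IsUnipotent u) {l : ℕ} (hl : 4 ≤ l)
    (hV : Module.finrank k V = 2 * l) (hX : ((u : Module.End k V) - 1) ^ (2 * l - 3) ≠ 0)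
    (hker : Even (Module.finrank k (LinearMap.ker ((u : Module.End k V) - 1))))
    (hW : DirectSum.IsInternal W) (hne : ∀ i, W i ≠ ⊥)
    (hσ : ∀ i, (W i).map (u : Module.End k V) = W (σ i)) {ν : Ω → Ω}
    (hν : Function.Involutive ν) (hνσ : ∀ i, ν (σ i) = σ (ν i))
    (hνd : ∀ i, Module.finrank k (W (ν i)) = Module.finrank k (W i))
    (hfix : ∀ i j, ν i = i → ν j = j → i = j) (hnt : ∃ i, ν i ≠ i) :
    (2 : k) = 0 ∧
    ((∃ a, σ a ≠ a ∧ σ (σ a) = a ∧ ν a = σ a ∧ ∀ i, i = a ∨ i = σ a) ∨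
     (∃ (s : ℕ) (C : Finset Ω) (b : Ω), 1 ≤ s ∧ C.card = 2 ^ s ∧ σ.IsCycleOn C ∧ b ∉ C ∧
        (∀ i, i ∈ C ∨ i = b) ∧ ν b = b ∧ Module.finrank k (W b) = 2) ∨
     (∃ (s : ℕ) (C : Finset Ω) (b c : Ω), C.card = 2 ^ s ∧ σ.IsCycleOn C ∧ b ∉ C ∧ c ∉ C ∧ b ≠ c ∧
        (∀ i, i ∈ C ∨ i = b ∨ i = c) ∧ σ b = c ∧ σ c = b ∧ ν b = c ∧
        Module.finrank k (W b) = 1 ∧ Module.finrank k (W c) = 1)) := by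
  have hfixσ : ∀ i, ν i = i → σ i = i := fun i hi => hfix _ _ (by rw [hνσ, hi]) hi
  have hpos : ∀ i, 1 ≤ Module.finrank k (W i) := fun i =>
    Submodule.one_le_finrank_iff.2 (hne i)
  obtain ⟨C, a, ha, hC, hdC⟩ := exists_large_orbit hu hW hσ hX
  have htot := sum_finrank_eq hW
  have hσC : ∀ i, σ i ∈ C ↔ i ∈ C := fun i => by exact_mod_cast hC.apply_mem_iff
  have hνpow : ∀ (n : ℕ) i, ν ((σ ^ n) i) = (σ ^ n) (ν i) := fun n i => by
    induction n with
    | zero => rfl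
    | succ n ih => rw [pow_succ', Equiv.Perm.mul_apply, Equiv.Perm.mul_apply, hνσ, ih]
  -- the large orbit is self-dual, because the space is too small for two of its kind
  have hνC : ∀ i ∈ C, ν i ∈ C := by
    have hνa : ν a ∈ C := by
      by_contra hνa
      have hdisj : Disjoint C (C.image ν) := by
        rw [Finset.disjoint_left]
        intro i hi hi'
        obtain ⟨j, hj, rfl⟩ := Finset.mem_image.1 hi'
        obtain ⟨n, -, rfl⟩ := hC.exists_pow_eq ha hj
        apply hνa
        rw [hνpow] at hi
        clear hi'
        induction n with
        | zero => exact hi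
        | succ n ih =>
          rw [pow_succ', Equiv.Perm.mul_apply, hσC] at hi
          refine ih ?_ hi
          have := hj
          rwa [pow_succ', Equiv.Perm.mul_apply, hσC] at this
      have h1 : ∑ i ∈ C ∪ C.image ν, Module.finrank k (W i) ≤ ∑ i, Module.finrank k (W i) :=
        Finset.sum_le_sum_of_subset (Finset.subset_univ _)
      rw [Finset.sum_union hdisj, Finset.sum_image hν.injective.injOn,
        Finset.sum_congr rfl fun i _ => hνd i] at h1
      omega
    intro i hi
    obtain ⟨n, -, rfl⟩ := hC.exists_pow_eq ha hi
    rw [hνpow]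
    clear hi
    induction n with
    | zero => exact hνa
    | succ n ih => rwa [pow_succ', Equiv.Perm.mul_apply, hσC]
  have hνC' : ∀ i, ν i ∈ C ↔ i ∈ C := fun i => ⟨fun h => hν i ▸ hνC _ h, hνC i⟩
  have hsplit := Finset.sum_add_sum_compl C fun i => Module.finrank k (W i)
  have hmulC : ∑ i ∈ C, Module.finrank k (W i) = C.card * Module.finrank k (W a) := by
    rw [Finset.sum_congr rfl fun i hi => finrank_eq_of_sameCycle hσ (hC.2 ha hi),
      Finset.sum_const, smul_eq_mul]
  have hcompl : Cᶜ.card ≤ ∑ i ∈ Cᶜ, Module.finrank k (W i) := by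
    simpa using Finset.card_nsmul_le_sum Cᶜ (fun i => Module.finrank k (W i)) 1 fun i _ => hpos i
  have hker3 := finrank_ker_add_le_of_pow_ne_zero hu hX
  -- in an orbit of odd size the involution `ν` has a fixed point, and there is at most one in all
  have hnotodd : ∀ b, b ∉ C → ν b = b → ¬ Odd C.card := fun b hbC hb hodd => by
    obtain ⟨c, hc, hcν⟩ := exists_fixedPoint_of_odd_card hodd hν hνC
    exact hbC (hfix c b hcν hb ▸ hc)
  have hodd := fun h2 : (2 : k) ≠ 0 => odd_card_of_two_ne_zero h2 hu hW hne hσ hC ha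
  obtain h0 | h0 | h0 : Cᶜ.card = 0 ∨ Cᶜ.card = 1 ∨ Cᶜ.card = 2 := by omega
  · -- one orbit
    have hall : ∀ i, i ∈ C := fun i => by
      have := Finset.card_eq_zero.1 h0
      by_contra hi
      simpa [this] using Finset.mem_compl.2 hi
    have hnotodd' : ¬ Odd C.card := fun hodd => by
      obtain ⟨c, hc, hcν⟩ := exists_fixedPoint_of_odd_card hodd hν hνC
      obtain ⟨i, hi⟩ := hnt
      have hic : c = i := (hC.2 hc (hall i)).eq_of_left (hfixσ c hcν)
      exact hi (hic ▸ hcν)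
    have h2 : (2 : k) = 0 := by
      by_contra h2
      exact hnotodd' (hodd h2)
    have hker2 := two_le_finrank_ker hu (hne a) hker
    have hcard := card_le_two_of_single_orbit h2 hu hW hne hσ hC hall (a := a) hX
      (by rw [Finset.compl_eq_empty_iff C |>.2 (Finset.eq_univ_iff_forall.2 hall)] at hsplit
          simp at hsplit; omega) hker2
    have hcard2 : C.card = 2 := by
      have := Finset.card_pos.2 ⟨a, ha⟩
      have h3 : C.card ≠ 1 := fun h => hnotodd' (h ▸ odd_one)
      omega
    have hσa : σ a ≠ a := fun h => by
      have h3 := (hC.pow_apply_eq ha (n := 1)).1 (by simpa using h)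
      rw [hcard2] at h3
      omega
    have hσσ : σ (σ a) = a := by
      have h3 := hC.pow_card_apply ha
      rwa [hcard2] at h3
    have hor : ∀ i, i = a ∨ i = σ a := fun i => by
      obtain ⟨n, hn, rfl⟩ := hC.exists_pow_eq ha (hall i)
      rw [hcard2] at hn
      interval_cases n
      · left; rfl
      · right; rfl
    refine ⟨h2, Or.inl ⟨a, hσa, hσσ, ?_, hor⟩⟩
    exact (hor (ν a)).resolve_left fun h => hσa (hfixσ a h)
  · -- a second orbit that is a single piece
    obtain ⟨b, hb⟩ := Finset.card_eq_one.1 h0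
    have hmem : ∀ i, i ∉ C ↔ i = b := fun i => by rw [← Finset.mem_compl, hb, Finset.mem_singleton]
    have hbC := (hmem b).2 rfl
    have hνb : ν b = b := (hmem _).1 (by rwa [hνC'])
    have hno := hnotodd b hbC hνb
    have h2 : (2 : k) = 0 := by
      by_contra h2
      exact hno (hodd h2)
    obtain ⟨s, hs⟩ := exists_card_eq_two_pow h2 hu hW hne hσ hC ha
    have hs1 : 1 ≤ s := Nat.one_le_iff_ne_zero.2 fun h => hno (by rw [hs, h]; exact odd_one)
    rw [hb, Finset.sum_singleton] at hsplit
    have hdvd : 2 ∣ ∑ i ∈ C, Module.finrank k (W i) := by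
      rw [hmulC, hs]
      exact (dvd_pow_self 2 (by omega)).mul_right _
    have := hpos b
    refine ⟨h2, Or.inr (Or.inl ⟨s, C, b, hs1, hs, hC, hbC, fun i => ?_, hνb, by omega⟩)⟩
    rw [← hmem i]
    exact em _
  · -- two further pieces, both one-dimensional
    obtain ⟨b, c, hbc, hbcC⟩ := Finset.card_eq_two.1 h0
    have hmem : ∀ i, i ∉ C ↔ i = b ∨ i = c := fun i => by
      rw [← Finset.mem_compl, hbcC, Finset.mem_insert, Finset.mem_singleton]
    have hbC := (hmem b).2 (Or.inl rfl)
    have hcC := (hmem c).2 (Or.inr rfl)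
    rw [hbcC, Finset.sum_pair hbc] at hsplit
    have hb1 := hpos b
    have hc1 := hpos c
    have hσb : σ b ≠ b := fun h => by
      -- otherwise `u` fixes both lines pointwise, as well as a vector of the large orbit
      have hσc : σ c = c := ((hmem (σ c)).1 (by rwa [hσC])).resolve_left fun h' =>
        hbc (σ.injective (h.trans h'.symm))
      have hline : ∀ d, σ d = d → Module.finrank k (W d) = 1 →
          W d ≤ LinearMap.ker ((u : Module.End k V) - 1) := fun d hd hd1 x hx => by
        have h1 := pow_finrank_apply_of_isNilpotent (P := W d) hu (fun y hy =>
          (W d).sub_mem (by simpa [hd] using pow_apply_mem hσ 1 hy) hy) hx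
        rwa [hd1, pow_one] at h1
      have hle : W b ⊔ W c ≤ LinearMap.ker ((u : Module.End k V) - 1) :=
        sup_le (hline b h (by omega)) (hline c hσc (by omega))
      have hind := hW.submodule_iSupIndep
      have hrank : Module.finrank k ↥(W b ⊔ W c) = 2 := by
        have h1 := Submodule.finrank_sup_add_finrank_inf_eq (W b) (W c)
        rw [(hind.pairwiseDisjoint hbc).eq_bot, finrank_bot] at h1
        omega
      have heq : W b ⊔ W c = LinearMap.ker ((u : Module.End k V) - 1) := by
        refine Submodule.eq_of_le_of_finrank_le hle ?_
        obtain ⟨r, hr⟩ := hker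
        omega
      have hWaC : W a ≤ C.sup W := Finset.le_sup ha
      obtain ⟨z, hz, hz0, hz1⟩ := exists_mem_ker_of_isNilpotent hu (P := C.sup W)
        (fun h' => hne a (eq_bot_iff.2 (h' ▸ hWaC)))
        (sub_one_apply_mem_sup hσ fun i hi => (hσC i).2 hi)
      have hz2 : z ∈ ({b, c} : Finset Ω).sup W := by
        rw [Finset.sup_insert, Finset.sup_singleton, heq]
        exact hz1
      refine hz0 (Submodule.disjoint_def.1 ?_ z hz hz2)
      exact (iSupIndep.supIndep' Finset.univ hind).disjoint_sup_sup (Finset.subset_univ _)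
        (Finset.subset_univ _) (hbcC ▸ disjoint_compl_right)
    have hσbc : σ b = c := ((hmem (σ b)).1 (by rwa [hσC])).resolve_left hσb
    have hσcb : σ c = b := ((hmem (σ c)).1 (by rwa [hσC])).resolve_right fun h =>
      hbc (σ.injective (hσbc.trans h.symm))
    have hνbc : ν b = c := ((hmem (ν b)).1 (by rwa [hνC'])).resolve_left fun h =>
      hσb (hfixσ b h)
    have h2 : (2 : k) = 0 := by
      by_contra h2
      have hD := isCycleOn_pair hσbc hσcb
      have := odd_card_of_two_ne_zero h2 hu hW hne hσ hD (a := b) (by simp)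
      rw [Finset.card_pair hbc] at this
      exact absurd this (by decide)
    obtain ⟨s, hs⟩ := exists_card_eq_two_pow h2 hu hW hne hσ hC ha
    refine ⟨h2, Or.inr (Or.inr ⟨s, C, b, c, hs, hC, hbC, hcC, hbc, fun i => ?_, hσbc, hσcb, hνbc,
      by omega, by omega⟩)⟩
    rw [← hmem i]
    exact em _

end Orbits

/-! ### Weights of a torus -/

section Weights

variable {k V : Type*} [Field k] [AddCommGroup V] [Module k V]

/-- Regular functions on `𝔾ₘⁿ` are linear combinations of characters. -/
lemma regularFunctions_le_span_monoidHom (n : ℕ) :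
    Subalgebra.toSubmodule (regularFunctions k (Fin n → k)) ≤
      Submodule.span k (Set.range fun χ : (Fin n → k)ˣ →* k => (χ : (Fin n → k)ˣ → k)) := by
  set S := Set.range fun χ : (Fin n → k)ˣ →* k => (χ : (Fin n → k)ˣ → k) with hS
  intro f hf
  rw [Subalgebra.mem_toSubmodule, regularFunctions] at hf
  have hsum : ∀ (ℓ : Module.Dual k (Fin n → k)) (χ : Fin n → ((Fin n → k)ˣ →* k)),
      (∑ i, ℓ (fun j => if i = j then 1 else 0) • (χ i : (Fin n → k)ˣ → k)) ∈
        Submodule.span k S := fun ℓ χ =>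
    sum_mem fun i _ => Submodule.smul_mem _ _ (Submodule.subset_span ⟨χ i, rfl⟩)
  induction hf using Algebra.adjoin_induction with
  | mem f hf =>
    rcases hf with ⟨ℓ, rfl⟩ | ⟨ℓ, rfl⟩
    · convert hsum ℓ fun i => (Pi.evalMonoidHom (fun _ => k) i).comp (Units.coeHom _) using 1
      ext g
      rw [LinearMap.pi_apply_eq_sum_univ ℓ]
      simp [mul_comm]
    · convert hsum ℓ fun i => ((Pi.evalMonoidHom (fun _ => k) i).comp (Units.coeHom _)).comp
        invMonoidHom using 1
      ext g
      rw [LinearMap.pi_apply_eq_sum_univ ℓ]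
      simp [mul_comm]
  | algebraMap r =>
    have : algebraMap k ((Fin n → k)ˣ → k) r =
        r • ((1 : (Fin n → k)ˣ →* k) : (Fin n → k)ˣ → k) := by
      ext g; simp
    rw [this]
    exact Submodule.smul_mem _ _ (Submodule.subset_span ⟨1, rfl⟩)
  | add f g _ _ hf hg => exact add_mem hf hg
  | mul f g _ _ hf hg =>
    have h1 := Submodule.mul_mem_mul hf hg
    rw [Submodule.span_mul_span] at h1
    refine Submodule.span_mono ?_ h1
    rintro _ ⟨_, ⟨χ, rfl⟩, _, ⟨ψ, rfl⟩, rfl⟩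
    exact ⟨χ * ψ, rfl⟩

variable {T : Subgroup (Module.End k V)ˣ}

/-- The matrix coefficients of a torus are linear combinations of characters. -/
lemma IsTorus.dual_apply_mem_span (hT : IsTorus T) (ℓ : Module.Dual k (Module.End k V)) :
    (fun t : T => ℓ ((t : (Module.End k V)ˣ) : Module.End k V)) ∈
      Submodule.span k (Set.range fun χ : T →* k => (χ : T → k)) := by
  obtain ⟨-, n, φ, hφ, -⟩ := hT
  have h1 := regularFunctions_le_span_monoidHom n
    (hφ (fun g => ℓ (g : Module.End k V)) (Algebra.subset_adjoin (Or.inl ⟨ℓ, rfl⟩)))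
  have h2 := Submodule.mem_map_of_mem (f := LinearMap.funLeft k k φ.symm) h1
  rw [Submodule.map_span] at h2
  have h3 : LinearMap.funLeft k k φ.symm
      (fun t => ℓ ((φ t : (Module.End k V)ˣ) : Module.End k V)) =
      fun t : T => ℓ ((t : (Module.End k V)ˣ) : Module.End k V) := by
    ext t
    simp [LinearMap.funLeft_apply]
  rw [h3] at h2
  refine Submodule.span_mono ?_ h2
  rintro _ ⟨_, ⟨χ, rfl⟩, rfl⟩
  exact ⟨χ.comp φ.symm.toMonoidHom, rfl⟩

lemma mem_weightSpace {χ : T →* kˣ} {v : V} :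
    v ∈ weightSpace T χ ↔
      ∀ t : T, ((t : (Module.End k V)ˣ) : Module.End k V) v = (χ t : k) • v := by
  simp [weightSpace]

/-- A torus is diagonalizable: expand `t v = ∑ χ(t) v_χ` and compare coefficients in
`s (t v) = (s t) v`. -/
lemma IsTorus.iSup_weightSpace [FiniteDimensional k V] (hT : IsTorus T) :
    ⨆ χ, weightSpace T χ = ⊤ := by
  rw [eq_top_iff]
  rintro v -
  let b := Module.finBasis k V
  have hc : ∀ i, ∃ c : (T →* k) →₀ k, ∀ t : T,
      b.coord i (((t : (Module.End k V)ˣ) : Module.End k V) v) = c.sum fun χ a => a * χ t := by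
    intro i
    have h1 := hT.dual_apply_mem_span (b.coord i ∘ₗ LinearMap.applyₗ v)
    rw [Finsupp.mem_span_range_iff_exists_finsupp] at h1
    obtain ⟨c, hc⟩ := h1
    refine ⟨c, fun t => ?_⟩
    have := congrFun hc t
    simp only [Finsupp.sum, Finset.sum_apply, Pi.smul_apply, smul_eq_mul] at this ⊢
    exact this.symm
  choose c hc using hc
  classical
  set S : Finset (T →* k) := Finset.univ.biUnion fun i => (c i).support with hS
  set A : (T →* k) → V := fun χ => ∑ i, c i χ • b i with hA
  have hexp : ∀ t : T, ((t : (Module.End k V)ˣ) : Module.End k V) v = ∑ χ ∈ S, χ t • A χ := by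
    intro t
    rw [← b.sum_repr (((t : (Module.End k V)ˣ) : Module.End k V) v)]
    simp only [hA, Finset.smul_sum]
    rw [Finset.sum_comm]
    refine Finset.sum_congr rfl fun i _ => ?_
    have h1 := hc i t
    rw [Module.Basis.coord_apply] at h1
    rw [h1, Finsupp.sum_of_support_subset (s := S) _
      (fun χ hχ => Finset.mem_biUnion.2 ⟨i, Finset.mem_univ _, hχ⟩) _ (by simp), Finset.sum_smul]
    exact Finset.sum_congr rfl fun χ _ => by rw [smul_smul, mul_comm]
  have hli := linearIndependent_monoidHom T k
  have hwt : ∀ χ ∈ S, ∀ s : T, ((s : (Module.End k V)ˣ) : Module.End k V) (A χ) = χ s • A χ := by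
    intro χ hχ s
    rw [← sub_eq_zero, ← Module.forall_dual_apply_eq_zero_iff k]
    intro f
    refine linearIndependent_iff'.1 hli S (fun χ => f
      (((s : (Module.End k V)ˣ) : Module.End k V) (A χ) - χ s • A χ)) ?_ χ hχ
    ext t
    have h1 : ((s : (Module.End k V)ˣ) : Module.End k V)
        (((t : (Module.End k V)ˣ) : Module.End k V) v) = ∑ χ ∈ S, (χ s * χ t) • A χ := by
      have := hexp (s * t)
      simpa only [Subgroup.coe_mul, Units.val_mul, Module.End.mul_apply, map_mul] using this
    rw [hexp t, map_sum] at h1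
    have h2 := congrArg f h1
    simp only [map_sum, map_smul, smul_eq_mul] at h2
    simp only [Finset.sum_apply, Pi.smul_apply, smul_eq_mul, map_sub, map_smul, sub_mul,
      Finset.sum_sub_distrib, Pi.zero_apply]
    rw [sub_eq_zero]
    refine (Finset.sum_congr rfl fun χ _ => ?_).trans
      (h2.trans (Finset.sum_congr rfl fun χ _ => ?_)) <;> ring
  have hv : v = ∑ χ ∈ S, A χ := by simpa using hexp 1
  rw [hv]
  refine sum_mem fun χ hχ => Submodule.mem_iSup_of_mem χ.toHomUnits ?_
  rw [mem_weightSpace]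
  exact hwt χ hχ

lemma IsTorus.mul_comm (hT : IsTorus T) (s t : T) : s * t = t * s := by
  obtain ⟨-, n, φ, -⟩ := hT
  apply φ.symm.injective
  rw [map_mul, map_mul, _root_.mul_comm]

lemma IsTorus.iSupIndep_weightSpace [FiniteDimensional k V] (hT : IsTorus T) :
    iSupIndep (weightSpace T) := by
  have h1 := Module.End.independent_iInf_maxGenEigenspace_of_forall_mapsTo
    (fun t : T => ((t : (Module.End k V)ˣ) : Module.End k V)) fun s t μ =>
      Module.End.mapsTo_maxGenEigenspace_of_comm (by
        have := congrArg (fun x : T => ((x : (Module.End k V)ˣ) : Module.End k V)) (hT.mul_comm t s)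
        simp only [Subgroup.coe_mul, Units.val_mul] at this
        exact this) μ
  have h2 := h1.comp (f := fun (χ : T →* kˣ) (t : T) => (χ t : k)) fun χ ψ h =>
    MonoidHom.ext fun t => Units.ext (congrFun h t)
  exact h2.mono fun χ => iInf_mono fun t => Module.End.genEigenspace_le_maximal _ _ 1

/-- Characters of a torus have no `2`-torsion, since a torus over an algebraically closed field is
a divisible group. -/
lemma IsTorus.eq_one_of_inv_eq [IsAlgClosed k] (hT : IsTorus T) {χ : T →* kˣ} (h : χ⁻¹ = χ) :
    χ = 1 := by
  obtain ⟨-, n, φ, -⟩ := hT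
  ext t
  obtain ⟨x, hx⟩ := φ.surjective t
  have hroot : ∀ i, ∃ z, z ^ 2 = (x : Fin n → k) i := fun i =>
    IsAlgClosed.exists_pow_nat_eq _ (by norm_num)
  choose z hz using hroot
  have hz2 : z ^ 2 = (x : Fin n → k) := funext hz
  obtain ⟨y, rfl⟩ : IsUnit z := by
    have : IsUnit (z ^ 2) := hz2 ▸ x.isUnit
    exact (isUnit_pow_iff two_ne_zero).1 this
  have hy : y ^ 2 = x := Units.ext (by simpa using hz2)
  have h1 : χ (φ y) ^ 2 = 1 := by
    have := DFunLike.congr_fun h (φ y)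
    rw [MonoidHom.inv_apply] at this
    rw [pow_two]
    nth_rewrite 1 [← this]
    exact inv_mul_cancel _
  rw [← hx, ← hy, map_pow, map_pow, h1, MonoidHom.one_apply]

lemma monoidHom_inv_inv (χ : T →* kˣ) : χ⁻¹⁻¹ = χ :=
  MonoidHom.ext fun t => by rw [MonoidHom.inv_apply, MonoidHom.inv_apply, inv_inv]

/-- Conjugation by the inverse of an element of the normalizer, as an automorphism of `T`. -/
lemma exists_conj_mulEquiv {u : (Module.End k V)ˣ}
    (hu : u ∈ Subgroup.normalizer (T : Set (Module.End k V)ˣ)) :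
    ∃ c : T ≃* T, ∀ t : T, ((c t : T) : (Module.End k V)ˣ) = u⁻¹ * t * u := by
  have hu' := inv_mem hu
  have h1 : ∀ t : T, u⁻¹ * t * u ∈ T := fun t => by
    have := (Subgroup.mem_normalizer_iff.1 hu' t).1 t.2
    simpa using this
  have h2 : ∀ t : T, u * t * u⁻¹ ∈ T := fun t => (Subgroup.mem_normalizer_iff.1 hu t).1 t.2
  exact ⟨{  toFun := fun t => ⟨u⁻¹ * t * u, h1 t⟩
            invFun := fun t => ⟨u * t * u⁻¹, h2 t⟩
            left_inv := fun t => Subtype.ext (by group)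
            right_inv := fun t => Subtype.ext (by group)
            map_mul' := fun s t => Subtype.ext (by simp [mul_assoc]) }, fun t => rfl⟩

lemma map_weightSpace {u : (Module.End k V)ˣ} {c : T ≃* T}
    (hc : ∀ t : T, ((c t : T) : (Module.End k V)ˣ) = u⁻¹ * t * u) (χ : T →* kˣ) :
    (weightSpace T χ).map (u : Module.End k V) = weightSpace T (χ.comp c.toMonoidHom) := by
  have hinv : ∀ x, (u : Module.End k V) (((u⁻¹ : (Module.End k V)ˣ) : Module.End k V) x) = x :=
    fun x => by rw [← Module.End.mul_apply, Units.mul_inv, Module.End.one_apply]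
  have hcu : ∀ (t : T) x, (u : Module.End k V) (((c t : (Module.End k V)ˣ) : Module.End k V) x) =
      ((t : (Module.End k V)ˣ) : Module.End k V) ((u : Module.End k V) x) := fun t x => by
    rw [hc, Units.val_mul, Units.val_mul, Module.End.mul_apply, Module.End.mul_apply, hinv]
  ext w
  rw [Submodule.mem_map]
  constructor
  · rintro ⟨x, hx, rfl⟩
    rw [mem_weightSpace] at hx ⊢
    intro t
    rw [← hcu, hx, map_smul]
    rfl
  · intro hw
    rw [mem_weightSpace] at hw
    refine ⟨_, ?_, hinv w⟩
    rw [mem_weightSpace]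
    intro t
    obtain ⟨s, rfl⟩ := c.surjective t
    apply ((Module.End.isUnit_iff _).1 u.isUnit).1
    rw [hcu, hinv, map_smul, hinv, hw]
    rfl

variable {Q : QuadraticForm k V}

lemma polarBilin_eq_zero_of_mem_weightSpace
    (hTQ : ∀ t ∈ T, ∀ v, Q ((t : Module.End k V) v) = Q v) {χ ψ : T →* kˣ} (h : ψ ≠ χ⁻¹)
    {x y : V} (hx : x ∈ weightSpace T χ) (hy : y ∈ weightSpace T ψ) : Q.polarBilin x y = 0 := by
  rw [mem_weightSpace] at hx hy
  by_contra h0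
  apply h
  ext t
  have h1 := polarBilin_apply_apply (hTQ t t.2) x y
  rw [hx, hy, map_smul, map_smul, LinearMap.smul_apply, smul_eq_mul, smul_eq_mul, ← mul_assoc] at h1
  have h2 : (ψ t * χ t : kˣ) = 1 := Units.ext (mul_right_cancel₀ h0 (by simpa using h1))
  rw [MonoidHom.inv_apply, eq_inv_of_mul_eq_one_left h2]

/-- The polar form embeds the weight space of `χ` into the dual of the weight space of `χ⁻¹`, as it
is orthogonal to all others. -/
lemma finrank_weightSpace_le_inv [FiniteDimensional k V] (hQ : Q.polarBilin.Nondegenerate)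
    (hT : IsTorus T) (hTQ : ∀ t ∈ T, ∀ v, Q ((t : Module.End k V) v) = Q v) (χ : T →* kˣ) :
    Module.finrank k (weightSpace T χ) ≤ Module.finrank k (weightSpace T χ⁻¹) := by
  rw [← Subspace.dual_finrank_eq (V := weightSpace T χ⁻¹)]
  refine LinearMap.finrank_le_finrank_of_injective
    (f := Q.polarBilin.domRestrict₁₂ (weightSpace T χ) (weightSpace T χ⁻¹)) ?_
  rw [injective_iff_map_eq_zero]
  intro x hx
  refine Subtype.ext (hQ.1 x fun y => ?_)
  have hy : y ∈ ⨆ χ, weightSpace T χ := by rw [hT.iSup_weightSpace]; trivial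
  induction hy using Submodule.iSup_induction' with
  | mem ψ y hy =>
    by_cases h : ψ = χ⁻¹
    · subst h
      exact LinearMap.congr_fun hx ⟨y, hy⟩
    · exact polarBilin_eq_zero_of_mem_weightSpace hTQ h x.2 hy
  | zero => exact map_zero _
  | add y z _ _ hy hz => rw [map_add, hy, hz, add_zero]

lemma finrank_weightSpace_inv [FiniteDimensional k V] (hQ : Q.polarBilin.Nondegenerate)
    (hT : IsTorus T) (hTQ : ∀ t ∈ T, ∀ v, Q ((t : Module.End k V) v) = Q v) (χ : T →* kˣ) :
    Module.finrank k (weightSpace T χ⁻¹) = Module.finrank k (weightSpace T χ) := by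
  refine le_antisymm ?_ (finrank_weightSpace_le_inv hQ hT hTQ χ)
  have h := finrank_weightSpace_le_inv hQ hT hTQ χ⁻¹
  rwa [monoidHom_inv_inv] at h

lemma exists_weight_ne_one [FiniteDimensional k V] (hT : IsTorus T) (h1 : T ≠ ⊥) :
    ∃ χ, weightSpace T χ ≠ ⊥ ∧ χ ≠ 1 := by
  by_contra! h
  apply h1
  rw [eq_bot_iff]
  intro t ht
  rw [Subgroup.mem_bot]
  refine Units.ext (LinearMap.ext fun v => ?_)
  have hv : v ∈ ⨆ χ, weightSpace T χ := by rw [hT.iSup_weightSpace]; trivial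
  induction hv using Submodule.iSup_induction' with
  | mem χ v hv =>
    by_cases hv0 : v = 0
    · simp [hv0]
    · obtain rfl := h χ ((Submodule.ne_bot_iff _).2 ⟨v, hv, hv0⟩)
      simpa using mem_weightSpace.1 hv ⟨t, ht⟩
  | zero => simp
  | add v w _ _ hv hw => rw [map_add, map_add, hv, hw]

end Weights

/-! ### Two summands interchanged by an isometry -/

section TwoPieces

variable {k V : Type*} [Field k] [AddCommGroup V] [Module k V]

variable {u : (Module.End k V)ˣ} {V₁ V₂ : Submodule k V}

/-- In characteristic two `(u - 1) ^ 2 = u ^ 2 - 1`, and this map commutes with `u`, so that it has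
the same nilpotency index on both subspaces. -/
lemma exists_sq_sub_one_pow_ne_zero (h2 : (2 : k) = 0)
    (h12 : V₁.map (u : Module.End k V) = V₂) (hsup : V₁ ⊔ V₂ = ⊤) {m : ℕ}
    (hX : ((u : Module.End k V) - 1) ^ (2 * m) ≠ 0) :
    ∃ w ∈ V₁, (((u : Module.End k V) ^ 2 - 1) ^ m : Module.End k V) w ≠ 0 := by
  by_contra! h
  apply hX
  have hsq : ((u : Module.End k V) - 1) ^ 2 = (u : Module.End k V) ^ 2 - 1 := by
    have h3 : ((u : Module.End k V) - 1) ^ 2 =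
        (u : Module.End k V) ^ 2 - 1 - (2 : k) • ((u : Module.End k V) - 1) := by
      rw [two_smul]
      noncomm_ring
    rw [h3, h2, zero_smul, sub_zero]
  rw [pow_mul, hsq]
  have hcomm : Commute (((u : Module.End k V) ^ 2 - 1) ^ m) (u : Module.End k V) :=
    (((Commute.refl _).pow_left 2).sub_left (Commute.one_left _)).pow_left m
  ext x
  obtain ⟨y, hy, z, hz, rfl⟩ := Submodule.mem_sup.1 (hsup ▸ trivial : x ∈ V₁ ⊔ V₂)
  rw [← h12] at hz
  obtain ⟨z, hz, rfl⟩ := hz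
  rw [map_add, h y hy, ← Module.End.mul_apply, hcomm.eq, Module.End.mul_apply, h z hz, map_zero,
    add_zero, LinearMap.zero_apply]

variable [FiniteDimensional k V]

/-- A unipotent map on a space of dimension `m + 2` with a cyclic subspace of dimension `m + 1` and
a kernel of dimension at least two has Jordan blocks of sizes `m + 1` and `1`. -/
lemma hasUnipotentJordanBlocksOn_of_pow_ne_zero {g : (Module.End k V)ˣ} (hg : IsUnipotent g)
    {P : Submodule k V} (hgP : ∀ x ∈ P, ((g : Module.End k V) - 1) x ∈ P) {m : ℕ}
    (hP : Module.finrank k P = m + 2)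
    (hker : 2 ≤ Module.finrank k ↥(P ⊓ LinearMap.ker ((g : Module.End k V) - 1))) {w : V}
    (hw : w ∈ P) (hm : (((g : Module.End k V) - 1) ^ m) w ≠ 0) :
    HasUnipotentJordanBlocksOn g P ![m + 1, 1] := by
  set Y := (g : Module.End k V) - 1 with hY
  have hYn : IsNilpotent Y := hg
  have hY0 : (Y ^ (m + 1)) w = 0 := pow_apply_eq_zero_of_finrank_lt hYn hgP (by omega) hw
  have hpow : ∀ j, (Y ^ j) w ∈ P := fun j => by
    induction j with
    | zero => simpa using hw
    | succ j ih => rw [pow_succ', Module.End.mul_apply]; exact hgP _ ih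
  have hli := linearIndependent_pow_apply Y hm hY0
  set C := Submodule.span k (Set.range fun j : Fin (m + 1) => (Y ^ (j : ℕ)) w) with hC
  have hwC : w ∈ C := Submodule.subset_span ⟨0, by simp⟩
  have hYC : ∀ x ∈ C, Y x ∈ C := by
    have : C.map Y ≤ C := by
      rw [hC, Submodule.map_span, Submodule.span_le]
      rintro _ ⟨_, ⟨j, rfl⟩, rfl⟩
      simp only [← Module.End.mul_apply, ← pow_succ']
      rcases Nat.lt_or_ge ((j : ℕ) + 1) (m + 1) with h | h
      · exact Submodule.subset_span ⟨⟨j + 1, h⟩, rfl⟩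
      · rw [show (j : ℕ) + 1 = m + 1 by omega, hY0]
        exact zero_mem _
    exact fun x hx => this (Submodule.mem_map_of_mem hx)
  -- the kernel on the cyclic subspace is a line, hence there is a kernel vector outside it
  obtain ⟨z, ⟨hzP, hz⟩, hzC⟩ : ∃ z ∈ P ⊓ LinearMap.ker Y, z ∉ C := by
    by_contra! h
    have h1 := Submodule.finrank_mono (le_inf h (inf_le_right : P ⊓ LinearMap.ker Y ≤ _))
    have h2 : Module.finrank k C = m + 1 := by rw [hC, finrank_span_eq_card hli, Fintype.card_fin]
    exact hm (pow_apply_eq_zero_of_finrank_lt hYn hYC (by omega) hwC)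
  have hz0 : Y z = 0 := hz
  have hsnoc : LinearIndependent k
      (Fin.snoc (fun j : Fin (m + 1) => (Y ^ (j : ℕ)) w) z : Fin (m + 2) → V) :=
    linearIndependent_finSnoc.2 ⟨hli, hzC⟩
  -- the family `w, Y w, …, Y ^ m w, z`, indexed by block and position in the block
  let F : (Σ i : Fin 2, Fin (![m + 1, 1] i)) → P := fun p =>
    if p.1 = 0 then ⟨(Y ^ (p.2 : ℕ)) w, hpow _⟩ else ⟨z, hzP⟩
  -- `Fin.ofNat` reduces modulo `m + 2`, which has no effect on positions below `m + 1`
  let idx : (Σ i : Fin 2, Fin (![m + 1, 1] i)) → Fin (m + 2) := fun p =>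
    if p.1 = 0 then Fin.ofNat (m + 2) (p.2 : ℕ) else Fin.last (m + 1)
  have hlt : ∀ j : Fin (![m + 1, 1] 0), (j : ℕ) < m + 1 := fun j => j.2
  have hidx0 : ∀ j : Fin (![m + 1, 1] 0), idx ⟨0, j⟩ = Fin.castSucc ⟨j, hlt j⟩ := fun j => by
    have := hlt j
    refine Fin.ext ?_
    simp only [idx, if_true, Fin.ofNat, Fin.val_castSucc]
    exact Nat.mod_eq_of_lt (by omega)
  have hidx1 : ∀ j : Fin (![m + 1, 1] 1), idx ⟨1, j⟩ = Fin.last (m + 1) := fun j => by simp [idx]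
  have hinj : Function.Injective idx := by
    rintro ⟨i, j⟩ ⟨i', j'⟩ h
    have hsub : ∀ j j' : Fin (![m + 1, 1] 1), j = j' := fun j j' =>
      Subsingleton.elim (α := Fin 1) j j'
    fin_cases i <;> fin_cases i'
    · have h1 := congrArg Fin.val ((hidx0 j).symm.trans (h.trans (hidx0 j')))
      simp only [Fin.val_castSucc] at h1
      have h2 : j = j' := Fin.ext h1
      rw [h2]
    · exact absurd ((hidx0 j).symm.trans (h.trans (hidx1 j'))) (Fin.castSucc_lt_last _).ne
    · exact absurd ((hidx0 j').symm.trans (h.symm.trans (hidx1 j))) (Fin.castSucc_lt_last _).ne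
    · rw [hsub j j']
  have hF : P.subtype ∘ F = (Fin.snoc (fun j : Fin (m + 1) => (Y ^ (j : ℕ)) w) z) ∘ idx := by
    funext ⟨i, j⟩
    fin_cases i
    · have := hidx0 j
      simp only [Function.comp_apply]
      erw [this, Fin.snoc_castSucc]
      rfl
    · have := hidx1 j
      simp only [Function.comp_apply]
      erw [this, Fin.snoc_last]
      rfl
  have hFli : LinearIndependent k F :=
    LinearIndependent.of_comp P.subtype (hF ▸ hsnoc.comp idx hinj)
  have hcard : Fintype.card (Σ i : Fin 2, Fin (![m + 1, 1] i)) = Module.finrank k P := by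
    rw [Fintype.card_sigma, Fin.sum_univ_two, Fintype.card_fin, Fintype.card_fin, hP]
    rfl
  have : Nonempty (Σ i : Fin 2, Fin (![m + 1, 1] i)) := ⟨⟨1, (0 : Fin 1)⟩⟩
  have hgY : ∀ x, (g : Module.End k V) x = x + Y x := fun x => by simp [hY]
  refine ⟨basisOfLinearIndependentOfCardEqFinrank hFli hcard, fun i j => ?_⟩
  rw [coe_basisOfLinearIndependentOfCardEqFinrank, hgY]
  congr 1
  fin_cases i
  · change Y ((Y ^ (j : ℕ)) w) = _
    rw [← Module.End.mul_apply, ← pow_succ']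
    split_ifs with h
    · rfl
    · have h1 : (j : ℕ) < m + 1 := hlt j
      have h2 : ¬ (j : ℕ) + 1 < m + 1 := h
      rw [show (j : ℕ) + 1 = m + 1 by omega, hY0]
  · rw [dif_neg (by
      have h1 : (j : ℕ) < 1 := j.2
      change ¬ (j : ℕ) + 1 < 1
      omega)]
    exact hz0

/-- When an isometry `u` interchanges two complementary totally isotropic subspaces, the alternating
form `B(v, u w) - B(w, u v)` on one of them has the fixed space of `u ^ 2` as its radical. -/
lemma even_finrank_of_interchange {Q : QuadraticForm k V} (hQ : Q.polarBilin.Nondegenerate)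
    (hu : ∀ v, Q ((u : Module.End k V) v) = Q v)
    (h12 : V₁.map (u : Module.End k V) = V₂) (h21 : V₂.map (u : Module.End k V) = V₁)
    (hsup : V₁ ⊔ V₂ = ⊤) (h1 : ∀ x ∈ V₁, ∀ y ∈ V₁, Q.polarBilin x y = 0)
    (hker : Module.finrank k ↥(V₁ ⊓ LinearMap.ker ((u : Module.End k V) ^ 2 - 1)) = 2) :
    Even (Module.finrank k V₁) := by
  set B := Q.polarBilin with hB
  have hsw : ∀ x y, B x y = B y x := polarBilin_swap Q
  have hBu : ∀ x y, B ((u : Module.End k V) x) ((u : Module.End k V) y) = B x y :=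
    polarBilin_apply_apply hu
  have hu2 : ∀ x ∈ V₁, ((u : Module.End k V) ^ 2) x ∈ V₁ := fun x hx => by
    rw [pow_two, Module.End.mul_apply, ← h21, ← h12]
    exact Submodule.mem_map_of_mem (Submodule.mem_map_of_mem hx)
  let γ : V₁ →ₗ[k] V₁ →ₗ[k] k := B.compl₁₂ V₁.subtype ((u : Module.End k V) ∘ₗ V₁.subtype)
  have hγ : ∀ v w : V₁, (γ - γ.flip) v w =
      B v ((u : Module.End k V) w) - B w ((u : Module.End k V) v) := fun v w => rfl
  have hγ' : ∀ v w : V₁, (γ - γ.flip) w v =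
      - B ((u : Module.End k V) v) (((u : Module.End k V) ^ 2 - 1 : Module.End k V) w) :=
      fun v w => by
    rw [hγ, LinearMap.sub_apply, map_sub, pow_two, Module.End.mul_apply, hBu,
      Module.End.one_apply, hsw _ (w : V)]
    ring
  have halt : (γ - γ.flip).IsAlt := fun v => by rw [hγ, sub_self]
  have heven := even_finrank_range_of_isAlt _ (γ - γ.flip) halt rfl
  have hrad : (LinearMap.ker (γ - γ.flip)).map V₁.subtype =
      V₁ ⊓ LinearMap.ker ((u : Module.End k V) ^ 2 - 1) := by
    ext w
    rw [Submodule.mem_map]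
    constructor
    · rintro ⟨w, hw, rfl⟩
      refine ⟨w.2, hQ.1 _ fun x => ?_⟩
      obtain ⟨y, hy, z, hz, rfl⟩ := Submodule.mem_sup.1 (hsup ▸ trivial : x ∈ V₁ ⊔ V₂)
      rw [← h12] at hz
      obtain ⟨z, hz, rfl⟩ := hz
      have h3 := hγ' ⟨z, hz⟩ w
      rw [LinearMap.mem_ker.1 hw, LinearMap.zero_apply, zero_eq_neg] at h3
      have hmem : ((u : Module.End k V) ^ 2 - 1 : Module.End k V) w ∈ V₁ :=
        V₁.sub_mem (hu2 _ w.2) w.2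
      rw [map_add, Submodule.subtype_apply, h1 _ hmem y hy, hsw, zero_add]
      exact h3
    · rintro ⟨hw, hw'⟩
      refine ⟨⟨w, hw⟩, LinearMap.ext fun v => ?_, rfl⟩
      rw [hγ', LinearMap.mem_ker.1 hw', map_zero, neg_zero, LinearMap.zero_apply]
  have h3 := LinearMap.finrank_range_add_finrank_ker (γ - γ.flip)
  rw [LinearEquiv.finrank_eq (Submodule.equivSubtypeMap V₁ (LinearMap.ker (γ - γ.flip))), hrad,
    hker] at h3
  rw [← h3]
  exact heven.add even_two

end TwoPieces

/-! ### Numbering the weights -/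

section Numbering

variable {k V : Type*} [Field k] [AddCommGroup V] [Module k V] {T : Subgroup (Module.End k V)ˣ}

lemma IsTorus.isWeightDecomposition [FiniteDimensional k V] (hT : IsTorus T) {r : ℕ}
    {f : Fin r → {χ : T →* kˣ // weightSpace T χ ≠ ⊥}} (hf : Function.Bijective f) :
    IsWeightDecomposition T fun i => (f i : T →* kˣ) := by
  have hinj : Function.Injective fun i => (f i : T →* kˣ) := Subtype.val_injective.comp hf.1
  refine ⟨hinj, fun ψ => ⟨fun h => ?_, ?_⟩, ?_⟩
  · obtain ⟨i, hi⟩ := hf.2 ⟨ψ, h⟩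
    exact ⟨i, congrArg Subtype.val hi⟩
  · rintro ⟨i, rfl⟩
    exact (f i).2
  · refine DirectSum.isInternal_submodule_of_iSupIndep_of_iSup_eq_top
      (hT.iSupIndep_weightSpace.comp hinj) ?_
    rw [← hT.iSup_weightSpace, ← iSup_ne_bot_subtype (weightSpace T)]
    exact hf.2.iSup_comp (g := fun χ : {χ : T →* kˣ // weightSpace T χ ≠ ⊥} => weightSpace T χ)

/-- If `f` maps the index set `S` onto a cycle of the permutation `σ` induced by `u`, then `u`
permutes the summands numbered by `S` transitively. -/
lemma permutesTransitively_of_isCycleOn {Ω : Type*} {W : Ω → Submodule k V}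
    {u : (Module.End k V)ˣ} {σ : Equiv.Perm Ω}
    (hσ : ∀ i, (W i).map (u : Module.End k V) = W (σ i)) {C : Finset Ω} (hC : σ.IsCycleOn C)
    {ι : Type*} {f : ι → Ω} {S : Set ι} (h1 : ∀ i ∈ S, f i ∈ C) (h2 : ∀ c ∈ C, ∃ i ∈ S, f i = c) :
    PermutesTransitively u (fun i => W (f i)) S := by
  refine ⟨fun i hi => ?_, fun i hi j hj => ?_⟩
  · obtain ⟨j, hj, hfj⟩ := h2 _ (by exact_mod_cast hC.apply_mem_iff.2 (h1 i hi))
    exact ⟨j, hj, by rw [hσ, ← hfj]⟩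
  · obtain ⟨m, hm⟩ := hC.2 (h1 i hi) (h1 j hj)
    exact ⟨m, by rw [map_zpow_eq hσ, hm]⟩

/-- A cycle of length `n` is enumerated by the powers of the permutation at one of its points. -/
lemma exists_enumeration {Ω : Type*} {σ : Equiv.Perm Ω} {C : Finset Ω} (hC : σ.IsCycleOn C)
    {n : ℕ} (hn : C.card = n) (hn0 : n ≠ 0) : ∃ g : ℕ → Ω, (∀ i, g i ∈ C) ∧
      (∀ c ∈ C, ∃ i < n, g i = c) ∧ ∀ i < n, ∀ j < n, g i = g j → i = j := by
  subst hn
  obtain ⟨a, ha⟩ := Finset.card_pos.1 (Nat.pos_of_ne_zero hn0)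
  refine ⟨fun i => (σ ^ i) a, fun i => ?_, fun c hc => ?_, fun i hi j hj h => ?_⟩
  · induction i with
    | zero => exact ha
    | succ i ih =>
      dsimp only at ih ⊢
      rw [pow_succ', Equiv.Perm.mul_apply]
      exact_mod_cast hC.apply_mem_iff.2 ih
  · exact hC.exists_pow_eq ha hc
  · exact Nat.ModEq.eq_of_lt_of_lt ((hC.pow_apply_eq_pow_apply ha).1 h) hi hj

end Numbering

end TorusOrth

open TorusOrth

theorem mainTheorem5 {k V : Type*} [Field k] [IsAlgClosed k] (p : ℕ) [CharP k p]
    [AddCommGroup V] [Module k V] [FiniteDimensional k V]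
    (Q : QuadraticForm k V) (hQ : Q.polarBilin.Nondegenerate)
    (l : ℕ) (hl : 4 ≤ l) (hV : Module.finrank k V = 2 * l)
    (T : Subgroup (Module.End k V)ˣ) (hT : TorusOrth.IsTorus T) (hT1 : T ≠ ⊥)
    (u : (Module.End k V)ˣ) (hu : TorusOrth.IsRegularUnipotent Q u)
    (huT : u ∈ Subgroup.normalizer (T : Set (Module.End k V)ˣ))
    (hX : ((T ⊔ Subgroup.zpowers u : Subgroup (Module.End k V)ˣ) : Set (Module.End k V)ˣ) ⊆
      TorusOrth.specialOrthogonal Q) :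
    p = 2 ∧
    ((Even l ∧ ∃ χ : Fin 2 → (T →* kˣ), TorusOrth.IsWeightDecomposition T χ ∧
        (TorusOrth.weightSpace T (χ 0)).map (u : Module.End k V) =
          TorusOrth.weightSpace T (χ 1) ∧
        (TorusOrth.weightSpace T (χ 1)).map (u : Module.End k V) =
          TorusOrth.weightSpace T (χ 0) ∧
        ∀ i : Fin 2, TorusOrth.HasUnipotentJordanBlocksOn (u ^ 2)
          (TorusOrth.weightSpace T (χ i)) ![l - 1, 1]) ∨
     (∃ s : ℕ, 1 ≤ s ∧ ∃ χ : Fin (2 ^ s + 1) → (T →* kˣ),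
        TorusOrth.IsWeightDecomposition T χ ∧
        TorusOrth.PermutesTransitively u (fun i => TorusOrth.weightSpace T (χ i))
          {i | (i : ℕ) < 2 ^ s} ∧
        χ (Fin.last (2 ^ s)) = 1 ∧
        Module.finrank k (TorusOrth.weightSpace T (χ (Fin.last (2 ^ s)))) = 2) ∨
     (∃ s : ℕ, ∃ χ : Fin (2 ^ s + 2) → (T →* kˣ),
        TorusOrth.IsWeightDecomposition T χ ∧
        TorusOrth.PermutesTransitively u (fun i => TorusOrth.weightSpace T (χ i))
          {i | (i : ℕ) < 2 ^ s} ∧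
        TorusOrth.PermutesTransitively u (fun i => TorusOrth.weightSpace T (χ i))
          {i | 2 ^ s ≤ (i : ℕ)} ∧
        (∀ i : Fin (2 ^ s + 2), 2 ^ s ≤ (i : ℕ) →
          Module.finrank k (TorusOrth.weightSpace T (χ i)) = 1) ∧
        (∀ i j : Fin (2 ^ s + 2), 2 ^ s ≤ (i : ℕ) → 2 ^ s ≤ (j : ℕ) → i ≠ j → χ i = (χ j)⁻¹))) := by
  classical
  have hTQ : ∀ t ∈ T, ∀ v, Q ((t : Module.End k V) v) = Q v := fun t ht =>
    (hX (Subgroup.mem_sup_left ht)).1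
  have hu1 : IsUnipotent u := hu.2.1
  have hpow := hu.sub_one_pow_ne_zero hQ (by omega) hV
  have hker : Even (Module.finrank k (LinearMap.ker ((u : Module.End k V) - 1))) := by
    have h1 := LinearMap.finrank_range_add_finrank_ker ((u : Module.End k V) - 1)
    have h2 : Even (Module.finrank k V) := hV ▸ even_two_mul l
    rw [← h1, Nat.even_add] at h2
    exact h2.1 hu.1.2
  -- the weights of `T`, permuted by `u`
  let Ω := {χ : T →* kˣ // weightSpace T χ ≠ ⊥}
  let W : Ω → Submodule k V := fun χ => weightSpace T χ
  have hne : ∀ i, W i ≠ ⊥ := fun i => i.2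
  have hind : iSupIndep W := hT.iSupIndep_weightSpace.comp Subtype.val_injective
  have : Finite Ω := WellFoundedGT.finite_of_iSupIndep hind hne
  have : Fintype Ω := Fintype.ofFinite Ω
  have hW : DirectSum.IsInternal W := by
    refine DirectSum.isInternal_submodule_of_iSupIndep_of_iSup_eq_top hind ?_
    rw [← hT.iSup_weightSpace]
    exact iSup_ne_bot_subtype (weightSpace T)
  obtain ⟨c, hc⟩ := exists_conj_mulEquiv huT
  have hmap : ∀ χ : T →* kˣ, weightSpace T χ ≠ ⊥ → weightSpace T (χ.comp c.toMonoidHom) ≠ ⊥ := by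
    intro χ hχ
    rw [← map_weightSpace hc, Ne, ← Submodule.finrank_eq_zero, finrank_map_unit,
      Submodule.finrank_eq_zero]
    exact hχ
  have hinj : Function.Injective fun χ : Ω => (⟨_, hmap χ χ.2⟩ : Ω) := fun χ ψ h => by
    refine Subtype.ext (MonoidHom.ext fun t => ?_)
    have := DFunLike.congr_fun (congrArg Subtype.val h) (c.symm t)
    simpa using this
  let σ : Equiv.Perm Ω := Equiv.ofBijective _ (Finite.injective_iff_bijective.1 hinj)
  have hσ : ∀ i, (W i).map (u : Module.End k V) = W (σ i) := fun i => map_weightSpace hc i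
  have hνne : ∀ χ : Ω, weightSpace T (χ : T →* kˣ)⁻¹ ≠ ⊥ := fun χ => by
    rw [Ne, ← Submodule.finrank_eq_zero, finrank_weightSpace_inv hQ hT hTQ,
      Submodule.finrank_eq_zero]
    exact χ.2
  -- the duality of the weights coming from the pairing of the weight spaces by the polar form
  let ν : Ω → Ω := fun χ => ⟨(χ : T →* kˣ)⁻¹, hνne χ⟩
  have hfix : ∀ i, ν i = i → (i : T →* kˣ) = 1 := fun i hi =>
    hT.eq_one_of_inv_eq (congrArg Subtype.val hi)
  obtain ⟨h2, hcases⟩ := orbit_classification (ν := ν) hu1 hl hV hpow hker hW hne hσ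
    (fun i => Subtype.ext (monoidHom_inv_inv _)) (fun i => Subtype.ext rfl)
    (fun i => finrank_weightSpace_inv hQ hT hTQ _)
    (fun i j hi hj => Subtype.ext ((hfix i hi).trans (hfix j hj).symm))
    (by
      obtain ⟨χ, hχ, hχ1⟩ := exists_weight_ne_one hT hT1
      exact ⟨⟨χ, hχ⟩, fun h => hχ1 (hfix _ h)⟩)
  have hp : p = 2 := by
    have : CharP k 2 := CharTwo.of_one_ne_zero_of_two_eq_zero one_ne_zero h2
    exact CharP.eq k ‹CharP k p› this
  refine ⟨hp, ?_⟩
  rcases hcases with ⟨a, hσa, hσσ, hνa, hall⟩ | ⟨s, C, b, hs, hCs, hC, hbC, hall, hνb, hb2⟩ |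
    ⟨s, C, b, d, hCs, hC, hbC, hdC, hbd, hall, hσb, hσd, hνb, hb1, hd1⟩
  · -- two weights, interchanged by `u`
    left
    have hsup : W a ⊔ W (σ a) = ⊤ := by
      rw [eq_top_iff, ← hW.submodule_iSup_eq_top, iSup_le_iff]
      intro i
      rcases hall i with h | h <;> rw [h]
      exacts [le_sup_left, le_sup_right]
    have hm12 := hσ a
    have hm21 := hσ (σ a)
    rw [hσσ] at hm21
    have hrank : ∀ i, Module.finrank k (W i) = l := by
      have h1 : Module.finrank k (W (σ a)) = Module.finrank k (W a) := by
        rw [← hm12, finrank_map_unit]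
      have h3 := Submodule.finrank_sup_add_finrank_inf_eq (W a) (W (σ a))
      rw [hsup, finrank_top, hV, (hind.pairwiseDisjoint hσa.symm).eq_bot, finrank_bot] at h3
      intro i
      rcases hall i with h | h <;> rw [h] <;> omega
    have hk2 := two_le_finrank_ker hu1 (hne a) hker
    have hk : ∀ i, 2 ≤ Module.finrank k
        ↥(W i ⊓ LinearMap.ker ((u : Module.End k V) ^ 2 - 1)) := fun i => by
      have h1 : σ.SameCycle a (σ a) := ⟨1, rfl⟩
      refine hk2.trans (finrank_ker_le_of_isCycleOn hW hσ (fun j => ?_) ?_)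
      · rcases hall i with h | h <;> rcases hall j with h' | h' <;> rw [h, h']
        exacts [h1, h1.symm]
      · rcases hall i with h | h <;> rw [h, pow_two, Equiv.Perm.mul_apply, hσσ]
    have hw : ∀ i, ∃ w ∈ W i,
        (((u : Module.End k V) ^ 2 - 1) ^ (l - 2) : Module.End k V) w ≠ 0 := fun i => by
      have h1 : ((u : Module.End k V) - 1) ^ (2 * (l - 2)) ≠ 0 := fun h =>
        hpow (pow_eq_zero_of_le (by omega) h)
      rcases hall i with h | h <;> rw [h]
      · exact exists_sq_sub_one_pow_ne_zero h2 hm12 hsup h1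
      · exact exists_sq_sub_one_pow_ne_zero h2 hm21 (sup_comm (W a) _ ▸ hsup) h1
    have hstab : ∀ i, ∀ x ∈ W i, ((u : Module.End k V) ^ 2 - 1 : Module.End k V) x ∈ W i :=
        fun i x hx => by
      have h1 := pow_apply_mem hσ 2 hx
      have h3 : (σ ^ 2) i = i := by
        rcases hall i with h | h <;> rw [h, pow_two, Equiv.Perm.mul_apply, hσσ]
      rw [h3] at h1
      exact (W i).sub_mem h1 hx
    have hnil := hu1.isNilpotent_pow_sub_one 2
    have hjordan : ∀ i, HasUnipotentJordanBlocksOn (u ^ 2) (W i) ![l - 1, 1] := fun i => by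
      obtain ⟨w, hwi, hw0⟩ := hw i
      have h1 := hasUnipotentJordanBlocksOn_of_pow_ne_zero (g := u ^ 2) (m := l - 2)
        (by rw [IsUnipotent, Units.val_pow_eq_pow_val]; exact hnil)
        (by rw [Units.val_pow_eq_pow_val]; exact hstab i) (by rw [hrank]; omega)
        (by rw [Units.val_pow_eq_pow_val]; exact hk i) hwi
        (by rw [Units.val_pow_eq_pow_val]; exact hw0)
      rwa [show l - 2 + 1 = l - 1 by omega] at h1
    refine ⟨?_, ![a.1, (σ a).1], ?_, hm12, hm21, ?_⟩
    · obtain ⟨w, hwa, hw0⟩ := hw a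
      rw [← hrank a]
      refine even_finrank_of_interchange hQ hu.1.1 hm12 hm21 hsup (fun x hx y hy => ?_)
        (le_antisymm ?_ (hk a))
      · refine polarBilin_eq_zero_of_mem_weightSpace hTQ (fun h => hσa ?_) hx hy
        rw [← hνa]
        exact Subtype.ext h.symm
      · by_contra! hlt
        exact hw0 (pow_apply_eq_zero_of_finrank_lt hnil (hstab a)
          (by rw [hrank]; omega) hwa)
    · have hf : Function.Bijective ![a, σ a] := by
        constructor
        · intro i j
          fin_cases i <;> fin_cases j <;> simp [hσa, hσa.symm]
        · intro i
          rcases hall i with h | h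
          · exact ⟨0, h.symm⟩
          · exact ⟨1, h.symm⟩
      convert hT.isWeightDecomposition hf using 2 with i
      fin_cases i <;> rfl
    · intro i
      fin_cases i
      · exact hjordan a
      · exact hjordan (σ a)
  · -- a large orbit and the zero weight
    right; left
    obtain ⟨g, hgC, hgs, hgi⟩ := exists_enumeration hC hCs (by positivity)
    let f : Fin (2 ^ s + 1) → Ω := fun i => if (i : ℕ) < 2 ^ s then g i else b
    have hf1 : ∀ i : Fin (2 ^ s + 1), (i : ℕ) < 2 ^ s → f i = g i := fun i hi => if_pos hi
    have hf2 : f (Fin.last _) = b := if_neg (by simp)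
    have hlast : ∀ i : Fin (2 ^ s + 1), ¬ (i : ℕ) < 2 ^ s → i = Fin.last _ := fun i hi =>
      Fin.ext (by rw [Fin.val_last]; omega)
    have hf : Function.Bijective f := by
      constructor
      · intro i j hij
        by_cases hi : (i : ℕ) < 2 ^ s <;> by_cases hj : (j : ℕ) < 2 ^ s
        · rw [hf1 i hi, hf1 j hj] at hij
          exact Fin.ext (hgi _ hi _ hj hij)
        · rw [hlast j hj, hf1 i hi, hf2] at hij
          exact absurd (hij ▸ hgC i) hbC
        · rw [hlast i hi, hf1 j hj, hf2] at hij
          exact absurd (hij ▸ hgC j) hbC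
        · rw [hlast i hi, hlast j hj]
      · intro x
        rcases hall x with hx | rfl
        · obtain ⟨i, hi, rfl⟩ := hgs x hx
          exact ⟨⟨i, by omega⟩, hf1 _ hi⟩
        · exact ⟨_, hf2⟩
    refine ⟨s, hs, fun i => f i, hT.isWeightDecomposition hf,
      permutesTransitively_of_isCycleOn (W := W) hσ hC (fun i hi => ?_) (fun x hx => ?_), ?_, ?_⟩
    · rw [hf1 i hi]; exact hgC i
    · obtain ⟨i, hi, rfl⟩ := hgs x hx
      exact ⟨⟨i, by omega⟩, hi, hf1 _ hi⟩
    · change ((f (Fin.last _) : Ω) : T →* kˣ) = 1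
      rw [hf2, hfix b hνb]
    · change Module.finrank k (W (f (Fin.last _))) = 2
      rw [hf2, hb2]
  · -- a large orbit and a pair of opposed weights
    right; right
    obtain ⟨g, hgC, hgs, hgi⟩ := exists_enumeration hC hCs (by positivity)
    let f : Fin (2 ^ s + 2) → Ω := fun i =>
      if (i : ℕ) < 2 ^ s then g i else if (i : ℕ) = 2 ^ s then b else d
    have hf1 : ∀ i : Fin (2 ^ s + 2), (i : ℕ) < 2 ^ s → f i = g i := fun i hi => if_pos hi
    have hf2 : ∀ i : Fin (2 ^ s + 2), (i : ℕ) = 2 ^ s → f i = b := fun i hi => by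
      simp [f, hi]
    have hf3 : ∀ i : Fin (2 ^ s + 2), (i : ℕ) = 2 ^ s + 1 → f i = d := fun i hi => by
      simp [f, hi]
    have hi3 : ∀ i : Fin (2 ^ s + 2),
        (i : ℕ) < 2 ^ s ∨ (i : ℕ) = 2 ^ s ∨ (i : ℕ) = 2 ^ s + 1 := fun i => by omega
    have hf : Function.Bijective f := by
      constructor
      · intro i j hij
        rcases hi3 i with hi | hi | hi <;> rcases hi3 j with hj | hj | hj <;>
          simp only [hf1, hf2, hf3, hi, hj] at hij
        · exact Fin.ext (hgi _ hi _ hj hij)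
        · exact absurd (hij ▸ hgC i) hbC
        · exact absurd (hij ▸ hgC i) hdC
        · exact absurd (hij ▸ hgC j) hbC
        · exact Fin.ext (hi.trans hj.symm)
        · exact absurd hij hbd
        · exact absurd (hij ▸ hgC j) hdC
        · exact absurd hij.symm hbd
        · exact Fin.ext (hi.trans hj.symm)
      · intro x
        rcases hall x with hx | rfl | rfl
        · obtain ⟨i, hi, rfl⟩ := hgs x hx
          exact ⟨⟨i, by omega⟩, hf1 _ hi⟩
        · exact ⟨⟨2 ^ s, by omega⟩, hf2 _ rfl⟩
        · exact ⟨⟨2 ^ s + 1, by omega⟩, hf3 _ rfl⟩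
    refine ⟨s, fun i => f i, hT.isWeightDecomposition hf,
      permutesTransitively_of_isCycleOn (W := W) hσ hC (fun i hi => ?_) (fun x hx => ?_),
      permutesTransitively_of_isCycleOn (W := W) hσ (isCycleOn_pair hσb hσd) (fun i hi => ?_)
        (fun x hx => ?_), fun i hi => ?_, fun i j hi hj hij => ?_⟩
    · rw [hf1 i hi]; exact hgC i
    · obtain ⟨i, hi, rfl⟩ := hgs x hx
      exact ⟨⟨i, by omega⟩, hi, hf1 _ hi⟩
    · rcases hi3 i with h | h | h
      · exact absurd h (not_lt.2 hi)
      · simp [hf2 i h]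
      · simp [hf3 i h]
    · rw [Finset.mem_insert, Finset.mem_singleton] at hx
      rcases hx with rfl | rfl
      · exact ⟨⟨2 ^ s, by omega⟩, le_refl (2 ^ s), hf2 _ rfl⟩
      · exact ⟨⟨2 ^ s + 1, by omega⟩, Nat.le_succ (2 ^ s), hf3 _ rfl⟩
    · change Module.finrank k (W (f i)) = 1
      rcases hi3 i with h | h | h
      · exact absurd h (not_lt.2 hi)
      · rw [hf2 i h, hb1]
      · rw [hf3 i h, hd1]
    · have hbd' : (b : T →* kˣ)⁻¹ = d := congrArg Subtype.val hνb
      change (f i : T →* kˣ) = (f j : T →* kˣ)⁻¹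
      rcases hi3 i with h | h | h <;> rcases hi3 j with h' | h' | h'
      any_goals omega
      · rw [hf2 i h, hf3 j h', ← hbd', monoidHom_inv_inv]
      · rw [hf3 i h, hf2 j h', hbd']
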